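/- Let $\omega\in(0,2\pi]$ and let $\Omega=\{(r\cos\varphi,r\sin\varphi)\in\mathbb R^2: 0<r<1,\ 0<\varphi<\omega\}$ be the circular sector of angle $\omega$. Let $k\in\mathbb N_0$, $m\in\mathbb N=\{1,2,\dots\}$, $\nu_k=k\pi/\omega$, let $J_{\nu}(x)=\sum_{j\ge 0}\frac{(-1)^j}{j!\,\Gamma(\nu+j+1)}\left(\frac x2\right)^{2j+\nu}$ be the Bessel function of the first kind, and let $\mu_{\nu_k,m}$ be the $m$-th positive zero of $J_{\nu_k}$. Then the Laplace eigenfunction of the sector, given in polar coordinates by $$u_{\nu_k,m}(r,\varphi)=J_{\nu_k}(\mu_{\nu_k,m}\,r)\cos(\nu_k\varphi),$$ satisfies $$u_{\nu_k,m}\in H^s(\Omega)\qquad\text{for all } s\ge 0 \text{ with } s<\nu_k+1 .$$ Here, for $s=n+\sigma$ with $n=\lfloor s\rfloor$ and $\sigma\in[0,1)$, the Sobolev(–Slobodeckij) space $H^s(\Omega)$ consists of the functions $u$ whose weak derivatives $D^\alpha u$, $|\alpha|\le n$, exist and lie in $L^2(\Omega)$ and, if $\sigma>0$, satisfy $$\int_\Omega\int_\Omega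 \frac{|D^\alpha u(x)-D^\alpha u(y)|^2}{d(x,y)^{2+2\sigma}}\,dy\,dx<\infty\qquad(|\alpha|=n),$$ where $d(x,y)=|x-y|$, except that in the case of the slit disc $\omega=2\pi$ with $k$ odd and $\sigma\ge\tfrac12$, $d(x,y)$ is the inner distance of $\Omega$, i.e. the infimum of the lengths of the paths in $\Omega$ from $x$ to $y$. (In all cases the membership also holds with the inner distance as $d$.) -/

import Mathlib

open scoped ENNReal

noncomputable section

/-- The Bessel function of the first kind of real order `ν`, by its series. -/
def besselJ (ν x : ℝ) : ℝ :=
  ∑' j : ℕ, (-1 : ℝ) ^ j / ((j.factorial : ℝ) * Real.Gamma (ν + j + 1)) *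
    (x / 2) ^ (2 * (j : ℝ) + ν)

/-- `μ` is the `m`-th positive zero (`m = 1, 2, …`) of the Bessel function `J_ν`. -/
def IsBesselZero (ν : ℝ) (m : ℕ) (μ : ℝ) : Prop :=
  0 < μ ∧ besselJ ν μ = 0 ∧
    {x : ℝ | 0 < x ∧ x ≤ μ ∧ besselJ ν x = 0}.Finite ∧
    {x : ℝ | 0 < x ∧ x ≤ μ ∧ besselJ ν x = 0}.ncard = m

/-- The open circular sector of radius `1` and angle `ω`. -/
def sector (ω : ℝ) : Set (EuclideanSpace ℝ (Fin 2)) :=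
  {x | ∃ r φ : ℝ, 0 < r ∧ r < 1 ∧ 0 < φ ∧ φ < ω ∧ x = !₂[r * Real.cos φ, r * Real.sin φ]}

/-- The polar angle of a point of the plane, taken in `[0, 2π)`. -/
def polarAngle (x : EuclideanSpace ℝ (Fin 2)) : ℝ :=
  toIcoMod Real.two_pi_pos 0 (Complex.arg ⟨x 0, x 1⟩)

/-- The function `J_ν(μ r) cos(ν φ)` of the polar coordinates `(r, φ)`, as a function on the
plane. -/
def eigenmode (ν μ : ℝ) (x : EuclideanSpace ℝ (Fin 2)) : ℝ :=
  besselJ ν (μ * ‖x‖) * Real.cos (ν * polarAngle x)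

/-- The defining formula of `eigenmode` in polar coordinates. -/
theorem eigenmode_polar (ν μ r φ : ℝ) (hr : 0 < r) (hφ : 0 ≤ φ) (hφ' : φ < 2 * Real.pi) :
    eigenmode ν μ !₂[r * Real.cos φ, r * Real.sin φ] =
      besselJ ν (μ * r) * Real.cos (ν * φ) := by
  have h1 : ‖(!₂[r * Real.cos φ, r * Real.sin φ] : EuclideanSpace ℝ (Fin 2))‖ = r := by
    rw [EuclideanSpace.norm_eq, Real.sqrt_eq_iff_mul_self_eq (by positivity) hr.le]
    simp only [Fin.sum_univ_two, Real.norm_eq_abs, sq_abs]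
    simp
    nlinarith [Real.sin_sq_add_cos_sq φ]
  have h2 : polarAngle !₂[r * Real.cos φ, r * Real.sin φ] = φ := by
    have e : (⟨r * Real.cos φ, r * Real.sin φ⟩ : ℂ) =
        r * (Complex.cos φ + Complex.sin φ * Complex.I) := by
      apply Complex.ext <;> simp [Complex.cos_ofReal_re, Complex.sin_ofReal_re]
    have h3 : polarAngle !₂[r * Real.cos φ, r * Real.sin φ] =
        toIcoMod Real.two_pi_pos 0 (Complex.arg ⟨r * Real.cos φ, r * Real.sin φ⟩) := by
      simp [polarAngle]
    rw [h3, e, Complex.arg_mul_cos_add_sin_mul_I_eq_toIocMod hr, toIcoMod_toIocMod,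
      toIcoMod_eq_self]
    exact ⟨hφ, by simpa using hφ'⟩
  rw [eigenmode, h1, h2]

/-- The partial derivative in the `i`-th Cartesian coordinate. -/
def partialDeriv (i : Fin 2) (f : EuclideanSpace ℝ (Fin 2) → ℝ) :
    EuclideanSpace ℝ (Fin 2) → ℝ :=
  fun x => fderiv ℝ f x (EuclideanSpace.single i 1)

/-- The classical derivative `D^α f` for a multi-index `α`. -/
def multiDeriv (α : Fin 2 → ℕ) (f : EuclideanSpace ℝ (Fin 2) → ℝ) :
    EuclideanSpace ℝ (Fin 2) → ℝ :=
  (partialDeriv 0)^[α 0] ((partialDeriv 1)^[α 1] f)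

/-- `v` is the weak derivative `D^α u` on the open set `Ω`. -/
def IsWeakDeriv (Ω : Set (EuclideanSpace ℝ (Fin 2))) (α : Fin 2 → ℕ)
    (u v : EuclideanSpace ℝ (Fin 2) → ℝ) : Prop :=
  MeasureTheory.LocallyIntegrableOn u Ω ∧ MeasureTheory.LocallyIntegrableOn v Ω ∧
    ∀ ψ : EuclideanSpace ℝ (Fin 2) → ℝ, ContDiff ℝ (⊤ : ℕ∞) ψ → HasCompactSupport ψ → tsupport ψ ⊆ Ω →
      ∫ x in Ω, u x * multiDeriv α ψ x = (-1) ^ (α 0 + α 1) * ∫ x in Ω, v x * ψ x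

/-- The square of the Slobodeckij seminorm of order `σ` on `Ω` (in dimension `2`), formed with the
distance function `d`. -/
def slobodeckijSq (d : EuclideanSpace ℝ (Fin 2) → EuclideanSpace ℝ (Fin 2) → ℝ≥0∞)
    (Ω : Set (EuclideanSpace ℝ (Fin 2))) (σ : ℝ) (v : EuclideanSpace ℝ (Fin 2) → ℝ) : ℝ≥0∞ :=
  ∫⁻ x in Ω, ∫⁻ y in Ω, ‖v x - v y‖ₑ ^ 2 / d x y ^ (2 + 2 * σ)

/-- `u ∈ H^s(Ω)` for an open set `Ω` and `s ≥ 0`, the Slobodeckij seminorms being formed with the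
distance function `d`. With `n = ⌊s⌋`, all weak derivatives of order at most `n` exist and
are square integrable, and, if `s` is not an integer, those of order `n` have a finite Slobodeckij
seminorm of order `s - n`. The usual space is the case `d = edist`. -/
def MemSobolev (d : EuclideanSpace ℝ (Fin 2) → EuclideanSpace ℝ (Fin 2) → ℝ≥0∞)
    (Ω : Set (EuclideanSpace ℝ (Fin 2))) (s : ℝ) (u : EuclideanSpace ℝ (Fin 2) → ℝ) : Prop :=
  ∃ g : (Fin 2 → ℕ) → EuclideanSpace ℝ (Fin 2) → ℝ, ∀ α : Fin 2 → ℕ, α 0 + α 1 ≤ ⌊s⌋₊ →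
    IsWeakDeriv Ω α u (g α) ∧
    MeasureTheory.MemLp (g α) 2 (MeasureTheory.volume.restrict Ω) ∧
    (α 0 + α 1 = ⌊s⌋₊ → (⌊s⌋₊ : ℝ) < s → slobodeckijSq d Ω (s - ⌊s⌋₊) (g α) < ⊤)

/-- The inner distance of `Ω`: the infimum of the lengths of the paths in `Ω` from `x` to `y`. -/
def innerEDist (Ω : Set (EuclideanSpace ℝ (Fin 2))) (x y : EuclideanSpace ℝ (Fin 2)) : ℝ≥0∞ :=
  ⨅ (γ : Path x y) (_ : ∀ t, γ t ∈ Ω), eVariationOn γ Set.univ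

end

/-! In polar coordinates with `φ ∈ (0, 2π)` the eigenmode is the real part of `z ^ ν * H`, where `H`
is a smooth function of `r ^ 2`, because `J_ν(x) / x ^ ν` is an even entire function. Each partial
derivative of such a function has the same form with `ν` lowered by one, so a derivative `v` of
order `n` is `O(r ^ b)` with gradient `O(r ^ (b - 1))`, where `b = ν - n`. Hence `v` is square
integrable when `b > -1`.

For the Slobodeckij seminorm one bounds `(v x - v y)²` by `(w x + w y) d(x, y) ^ q` with an
integrable weight `w` and `q > 2σ`; the remaining kernel `d(x, y) ^ (q - 2 - 2σ)` is integrable.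
When `d` is the inner distance, `w` is a multiple of `r ^ (2b - q)`: integrate the gradient along a
path if `d(x, y) < r / 2`, and bound the two values separately otherwise. For `ω < 2π` the inner
distance is comparable with the Euclidean one. For the slit disc and even `k`, the exponent `ν` is
an integer and the eigenmode is smooth across the slit. For `σ < 1/2` the jump across the slit is
absorbed by an additional weight, a multiple of `r ^ (2b) |x₁| ^ (-q)`, where `x₁` is the second
coordinate and `2σ < q < 1`. -/

noncomputable section

open MeasureTheory Metric Set
open scoped NNReal Pointwise

local notation "ℝ²" => EuclideanSpace ℝ (Fin 2)

section Derivatives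

open scoped ContDiff

theorem partialDeriv_iterate_induction {P : ℕ → (ℝ² → ℝ) → Prop}
    (succ : ∀ i n g, P n g → P (n + 1) (partialDeriv i g)) (i : Fin 2) (k : ℕ) {n : ℕ}
    {f : ℝ² → ℝ} (hf : P n f) : P (n + k) ((partialDeriv i)^[k] f) := by
  induction k with
  | zero => exact hf
  | succ k ih =>
    rw [Function.iterate_succ_apply']
    exact succ i _ _ ih

theorem multiDeriv_induction {P : ℕ → (ℝ² → ℝ) → Prop} {f : ℝ² → ℝ}
    (succ : ∀ i n g, P n g → P (n + 1) (partialDeriv i g)) (α : Fin 2 → ℕ) (zero : P 0 f) :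
    P (α 0 + α 1) (multiDeriv α f) := by
  have h := partialDeriv_iterate_induction succ 0 (α 0)
    (partialDeriv_iterate_induction succ 1 (α 1) zero)
  rwa [zero_add, add_comm] at h

variable {Ω : Set ℝ²} {f g : ℝ² → ℝ}

theorem contDiff_partialDeriv (i : Fin 2) (hf : ContDiff ℝ ∞ f) :
    ContDiff ℝ ∞ (partialDeriv i f) :=
  (hf.fderiv_right (m := ∞) (by simp)).clm_apply contDiff_const

theorem contDiffOn_partialDeriv (hΩ : IsOpen Ω) (i : Fin 2) (hf : ContDiffOn ℝ ∞ f Ω) :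
    ContDiffOn ℝ ∞ (partialDeriv i f) Ω :=
  (hf.fderiv_of_isOpen (m := ∞) hΩ (by simp)).clm_apply contDiffOn_const

theorem contDiffOn_partialDeriv_iterate (hΩ : IsOpen Ω) (i : Fin 2) (n : ℕ)
    (hf : ContDiffOn ℝ ∞ f Ω) : ContDiffOn ℝ ∞ ((partialDeriv i)^[n] f) Ω :=
  partialDeriv_iterate_induction (P := fun _ g => ContDiffOn ℝ ∞ g Ω) (n := 0)
    (fun i _ _ => contDiffOn_partialDeriv hΩ i) i n hf

theorem contDiffOn_multiDeriv (hΩ : IsOpen Ω) (α : Fin 2 → ℕ) (hf : ContDiffOn ℝ ∞ f Ω) :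
    ContDiffOn ℝ ∞ (multiDeriv α f) Ω :=
  multiDeriv_induction (P := fun _ g => ContDiffOn ℝ ∞ g Ω)
    (fun i _ _ => contDiffOn_partialDeriv hΩ i) α hf

theorem partialDeriv_congr (hΩ : IsOpen Ω) (i : Fin 2) (h : EqOn f g Ω) :
    EqOn (partialDeriv i f) (partialDeriv i g) Ω := fun x hx => by
  rw [partialDeriv, partialDeriv, (h.eventuallyEq_of_mem (hΩ.mem_nhds hx)).fderiv_eq]

theorem tsupport_partialDeriv_subset (i : Fin 2) : tsupport (partialDeriv i f) ⊆ tsupport f :=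
  tsupport_fderiv_apply_subset ℝ _

theorem partialDeriv_comm (hf : ContDiff ℝ ∞ f) (i j : Fin 2) :
    partialDeriv i (partialDeriv j f) = partialDeriv j (partialDeriv i f) := by
  have second_deriv (k l : Fin 2) (x : ℝ²) : partialDeriv k (partialDeriv l f) x =
      fderiv ℝ (fderiv ℝ f) x (EuclideanSpace.single k 1) (EuclideanSpace.single l 1) := by
    have hd : DifferentiableAt ℝ (fderiv ℝ f) x :=
      (hf.fderiv_right (m := ∞) (by simp)).differentiable (by simp) x
    change fderiv ℝ (fun y => fderiv ℝ f y (EuclideanSpace.single l 1)) x _ = _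
    rw [fderiv_clm_apply hd (differentiableAt_const _)]
    simp
  ext x
  rw [second_deriv, second_deriv]
  exact (contDiff_infty.1 hf 2).contDiffAt.isSymmSndFDerivAt (by simp) _ _

theorem partialDeriv_iterate_comm (hf : ContDiff ℝ ∞ f) (i j : Fin 2) (m n : ℕ) :
    (partialDeriv i)^[m] ((partialDeriv j)^[n] f) =
      (partialDeriv j)^[n] ((partialDeriv i)^[m] f) := by
  have single (n : ℕ) : ∀ f : ℝ² → ℝ, ContDiff ℝ ∞ f →
      partialDeriv i ((partialDeriv j)^[n] f) = (partialDeriv j)^[n] (partialDeriv i f) := by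
    induction n with
    | zero => exact fun _ _ => rfl
    | succ n ih =>
      intro f hf
      rw [Function.iterate_succ_apply, ih _ (contDiff_partialDeriv j hf), partialDeriv_comm hf,
        Function.iterate_succ_apply]
  induction m generalizing f with
  | zero => rfl
  | succ m ih =>
    rw [Function.iterate_succ_apply, single n f hf, ih (contDiff_partialDeriv i hf),
      Function.iterate_succ_apply]

theorem norm_fderiv_le_add_abs_partialDeriv (f : ℝ² → ℝ) (x : ℝ²) :
    ‖fderiv ℝ f x‖ ≤ |partialDeriv 0 f x| + |partialDeriv 1 f x| := by
  refine ContinuousLinearMap.opNorm_le_bound _ (by positivity) fun v => ?_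
  have hv : v = v 0 • EuclideanSpace.single 0 1 + v 1 • EuclideanSpace.single 1 1 := by
    ext i
    fin_cases i <;> simp
  have hcoord (i : Fin 2) : |v i| ≤ ‖v‖ := PiLp.norm_apply_le v i
  calc ‖fderiv ℝ f x v‖ = |v 0 * partialDeriv 0 f x + v 1 * partialDeriv 1 f x| := by
        conv_lhs => rw [hv]
        rw [map_add, map_smul, map_smul]; rfl
    _ ≤ |v 0| * |partialDeriv 0 f x| + |v 1| * |partialDeriv 1 f x| := by
        rw [← abs_mul, ← abs_mul]
        exact abs_add_le _ _
    _ ≤ ‖v‖ * |partialDeriv 0 f x| + ‖v‖ * |partialDeriv 1 f x| := by gcongr <;> exact hcoord _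
    _ = (|partialDeriv 0 f x| + |partialDeriv 1 f x|) * ‖v‖ := by ring

end Derivatives

section WeakDerivatives

open scoped ContDiff

variable {Ω : Set ℝ²} {u v ψ : ℝ² → ℝ}

theorem integrable_mul_of_tsupport_subset (hΩ : IsOpen Ω) (hv : ContinuousOn v Ω)
    (hψ : Continuous ψ) (hc : HasCompactSupport ψ) (hs : tsupport ψ ⊆ Ω) :
    Integrable fun x => v x * ψ x := by
  refine Continuous.integrable_of_hasCompactSupport (continuous_of_tsupport fun x hx => ?_)
    hc.mul_left
  have hxΩ := hs (tsupport_mul_subset_right hx)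
  exact (hv.continuousAt (hΩ.mem_nhds hxΩ)).mul hψ.continuousAt

theorem integral_mul_partialDeriv (hΩ : IsOpen Ω) (i : Fin 2) (hv : ContDiffOn ℝ ∞ v Ω)
    (hψ : ContDiff ℝ ∞ ψ) (hc : HasCompactSupport ψ) (hs : tsupport ψ ⊆ Ω) :
    ∫ x in Ω, v x * partialDeriv i ψ x = -∫ x in Ω, partialDeriv i v x * ψ x := by
  have hsub := tsupport_partialDeriv_subset (f := ψ) i
  have outside (w : ℝ² → ℝ) {θ : ℝ² → ℝ} (hθ : tsupport θ ⊆ tsupport ψ) :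
      ∫ x in Ω, w x * θ x = ∫ x, w x * θ x :=
    setIntegral_eq_integral_of_forall_compl_eq_zero fun x hx => by
      rw [image_eq_zero_of_notMem_tsupport fun h => hx (hs (hθ h)), mul_zero]
  rw [outside _ hsub, outside _ subset_rfl]
  exact integral_mul_fderiv_eq_neg_fderiv_mul_of_integrable
    (integrable_mul_of_tsupport_subset hΩ (contDiffOn_partialDeriv hΩ i hv).continuousOn
      hψ.continuous hc hs)
    (integrable_mul_of_tsupport_subset hΩ hv.continuousOn
      (contDiff_partialDeriv i hψ).continuous
      (hc.mono' (subset_closure.trans hsub)) (hsub.trans hs))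
    (integrable_mul_of_tsupport_subset hΩ hv.continuousOn hψ.continuous hc hs)
    (fun x hx => (hv.contDiffAt (hΩ.mem_nhds (hs hx))).differentiableAt (by simp))
    (fun x _ => hψ.differentiable (by simp) x)

theorem integral_mul_partialDeriv_iterate (hΩ : IsOpen Ω) (i : Fin 2) (n : ℕ)
    (hv : ContDiffOn ℝ ∞ v Ω) (hψ : ContDiff ℝ ∞ ψ) (hc : HasCompactSupport ψ)
    (hs : tsupport ψ ⊆ Ω) :
    ∫ x in Ω, v x * (partialDeriv i)^[n] ψ x =
      (-1) ^ n * ∫ x in Ω, (partialDeriv i)^[n] v x * ψ x := by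
  induction n generalizing ψ with
  | zero => simp
  | succ n ih =>
    have hsub := tsupport_partialDeriv_subset (f := ψ) i
    rw [Function.iterate_succ_apply, ih (contDiff_partialDeriv i hψ)
      (hc.mono' (subset_closure.trans hsub)) (hsub.trans hs),
      integral_mul_partialDeriv hΩ i (contDiffOn_partialDeriv_iterate hΩ i n hv) hψ hc hs,
      Function.iterate_succ_apply']
    ring

theorem isWeakDeriv_multiDeriv (hΩ : IsOpen Ω) (α : Fin 2 → ℕ) (hu : ContDiffOn ℝ ∞ u Ω) :
    IsWeakDeriv Ω α u (multiDeriv α u) := by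
  refine ⟨hu.continuousOn.locallyIntegrableOn hΩ.measurableSet,
    (contDiffOn_multiDeriv hΩ α hu).continuousOn.locallyIntegrableOn hΩ.measurableSet,
    fun ψ hψ hc hs => ?_⟩
  obtain ⟨hψ', hsub⟩ : ContDiff ℝ ∞ ((partialDeriv 0)^[α 0] ψ) ∧
      tsupport ((partialDeriv 0)^[α 0] ψ) ⊆ tsupport ψ :=
    partialDeriv_iterate_induction
      (P := fun _ g => ContDiff ℝ ∞ g ∧ tsupport g ⊆ tsupport ψ) (n := 0)
      (fun i _ _ h => ⟨contDiff_partialDeriv i h.1, (tsupport_partialDeriv_subset i).trans h.2⟩)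
      0 (α 0) ⟨hψ, subset_rfl⟩
  calc ∫ x in Ω, u x * multiDeriv α ψ x
      = ∫ x in Ω, u x * (partialDeriv 1)^[α 1] ((partialDeriv 0)^[α 0] ψ) x := by
        rw [multiDeriv, partialDeriv_iterate_comm hψ]
    _ = (-1) ^ α 1 * ∫ x in Ω, (partialDeriv 1)^[α 1] u x * (partialDeriv 0)^[α 0] ψ x :=
        integral_mul_partialDeriv_iterate hΩ 1 (α 1) hu hψ'
          (hc.mono' (subset_closure.trans hsub)) (hsub.trans hs)
    _ = (-1) ^ (α 0 + α 1) * ∫ x in Ω, multiDeriv α u x * ψ x := by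
        rw [integral_mul_partialDeriv_iterate hΩ 0 (α 0)
          (contDiffOn_partialDeriv_iterate hΩ 1 (α 1) hu) hψ hc hs, multiDeriv]
        ring

end WeakDerivatives

section MemSobolev

variable {d : ℝ² → ℝ² → ℝ≥0∞} {Ω : Set ℝ²} {s σ : ℝ} {u v : ℝ² → ℝ}

theorem slobodeckijSq_congr (hΩ : MeasurableSet Ω) (h : EqOn u v Ω) :
    slobodeckijSq d Ω σ u = slobodeckijSq d Ω σ v :=
  setLIntegral_congr_fun hΩ fun x hx => setLIntegral_congr_fun hΩ fun y hy => by
    simp only [h hx, h hy]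

theorem MemSobolev.congr (hΩ : MeasurableSet Ω) (h : EqOn u v Ω) (hu : MemSobolev d Ω s u) :
    MemSobolev d Ω s v := by
  obtain ⟨g, hg⟩ := hu
  refine ⟨g, fun α hα => ⟨?_, (hg α hα).2⟩⟩
  obtain ⟨hloc, hglob, hint⟩ := (hg α hα).1
  refine ⟨hloc.congr ((ae_restrict_mem hΩ).mono fun x hx => h hx), hglob,
    fun ψ hψ hc hs => ?_⟩
  rw [← hint ψ hψ hc hs]
  exact setIntegral_congr_fun hΩ fun x hx => by simp only [h hx]

end MemSobolev

section Integrability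

variable {E : Type*} [NormedAddCommGroup E] [MeasurableSpace E] [BorelSpace E] {μ : Measure E}
  {s : Set E}

theorem integrableOn_norm_rpow [NormedSpace ℝ E] [FiniteDimensional ℝ E] [Nontrivial E]
    [μ.IsAddHaarMeasure] (hs : Bornology.IsBounded s) {p : ℝ} (hp : -Module.finrank ℝ E < p) :
    IntegrableOn (fun x => ‖x‖ ^ p) s μ := by
  obtain ⟨R, hR⟩ := hs.subset_ball 0
  refine (integrableOn_ball_of_norm_le_rpow (C := 1) (α := -p) Module.finrank_pos (by linarith)
    (.of_forall fun x => ?_) (measurable_norm.pow_const p).aestronglyMeasurable).mono_set hR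
  rw [one_mul, neg_neg, Real.norm_of_nonneg (by positivity)]

theorem setLIntegral_sub_left_le [μ.IsAddLeftInvariant] [μ.IsNegInvariant] (hs : MeasurableSet s)
    (κ : E → ℝ≥0∞) {x : E} (hx : x ∈ s) :
    ∫⁻ y in s, κ (x - y) ∂μ ≤ ∫⁻ z in s - s, κ z ∂μ := by
  rw [← lintegral_indicator hs]
  calc ∫⁻ y, s.indicator (fun y => κ (x - y)) y ∂μ
      ≤ ∫⁻ y, (s - s).indicator κ (x - y) ∂μ := by
        refine lintegral_mono (indicator_le fun y hy => ?_)
        rw [indicator_of_mem (sub_mem_sub hx hy)]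
    _ = ∫⁻ z, (s - s).indicator κ z ∂μ := lintegral_sub_left_eq_self _ x
    _ ≤ ∫⁻ z in s - s, κ z ∂μ := lintegral_indicator_le _ _

theorem lintegral_lintegral_add_mul_sub_le [SecondCountableTopology E] [SFinite μ]
    [μ.IsAddLeftInvariant] [μ.IsNegInvariant]
    (hs : MeasurableSet s) {w κ : E → ℝ≥0∞} (hw : Measurable w) (hκ : Measurable κ)
    (hκ' : ∀ z, κ (-z) = κ z) :
    ∫⁻ x in s, ∫⁻ y in s, (w x + w y) * κ (x - y) ∂μ ∂μ ≤
      2 * ((∫⁻ x in s, w x ∂μ) * ∫⁻ z in s - s, κ z ∂μ) := by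
  have hm : Measurable fun p : E × E => w p.1 * κ (p.1 - p.2) := by fun_prop
  have key : ∫⁻ x in s, ∫⁻ y in s, w x * κ (x - y) ∂μ ∂μ ≤
      (∫⁻ x in s, w x ∂μ) * ∫⁻ z in s - s, κ z ∂μ := by
    rw [← lintegral_mul_const _ hw]
    refine setLIntegral_mono' hs fun x hx => ?_
    rw [lintegral_const_mul _ (by fun_prop)]
    gcongr w x * ?_
    exact setLIntegral_sub_left_le hs κ hx
  have swap : ∫⁻ x in s, ∫⁻ y in s, w y * κ (x - y) ∂μ ∂μ =
      ∫⁻ x in s, ∫⁻ y in s, w x * κ (x - y) ∂μ ∂μ := by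
    rw [lintegral_lintegral_swap (by fun_prop)]
    refine lintegral_congr fun x => lintegral_congr fun y => ?_
    rw [← hκ', neg_sub]
  calc ∫⁻ x in s, ∫⁻ y in s, (w x + w y) * κ (x - y) ∂μ ∂μ
      = ∫⁻ x in s, ∫⁻ y in s, w x * κ (x - y) ∂μ ∂μ +
          ∫⁻ x in s, ∫⁻ y in s, w y * κ (x - y) ∂μ ∂μ := by
        rw [← lintegral_add_left hm.lintegral_prod_right']
        refine lintegral_congr fun x => ?_
        rw [← lintegral_add_left (by fun_prop)]
        simp only [add_mul]
    _ ≤ 2 * ((∫⁻ x in s, w x ∂μ) * ∫⁻ z in s - s, κ z ∂μ) := by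
        rw [swap, two_mul]
        gcongr

theorem memLp_two_of_abs_le_norm_rpow {Ω : Set ℝ²} (hΩ : MeasurableSet Ω)
    (hb : Bornology.IsBounded Ω) {v : ℝ² → ℝ} (hv : ContinuousOn v Ω) {C b : ℝ} (hb1 : -1 < b)
    (h : ∀ x ∈ Ω, |v x| ≤ C * ‖x‖ ^ b) : MemLp v 2 (volume.restrict Ω) := by
  have hm := hv.aestronglyMeasurable (μ := volume) hΩ
  have hint : IntegrableOn (fun x : ℝ² => C ^ 2 * ‖x‖ ^ (2 * b)) Ω :=
    (integrableOn_norm_rpow hb (by simp; linarith)).const_mul _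
  rw [memLp_two_iff_integrable_sq hm]
  refine hint.mono' (hm.pow 2) ((ae_restrict_mem hΩ).mono fun x hx => ?_)
  calc ‖v x ^ 2‖ = |v x| ^ 2 := by rw [norm_pow, Real.norm_eq_abs]
    _ ≤ (C * ‖x‖ ^ b) ^ 2 := by gcongr; exact h x hx
    _ = C ^ 2 * ‖x‖ ^ (2 * b) := by
        rw [mul_pow, mul_comm 2 b, ← Real.rpow_mul_natCast (norm_nonneg x) b 2, Nat.cast_ofNat]

end Integrability

section HajlaszWeights

/-- A weight `w` for which `v` satisfies the pointwise estimate
`(v x - v y)² ≤ (w x + w y) d(x, y) ^ q` on `Ω`, integrable over `Ω`. This is the square of a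
generalized Hajłasz gradient of order `q / 2`; points at infinite distance are not compared. -/
structure IsHajlaszWeight (d : ℝ² → ℝ² → ℝ≥0∞) (Ω : Set ℝ²) (q : ℝ) (v w : ℝ² → ℝ) : Prop where
  measurable : Measurable w
  nonneg : ∀ x, 0 ≤ w x
  integrableOn : IntegrableOn w Ω
  sq_sub_le : ∀ x ∈ Ω, ∀ y ∈ Ω, d x y ≠ ⊤ → (v x - v y) ^ 2 ≤ (w x + w y) * (d x y).toReal ^ q

namespace IsHajlaszWeight

variable {d d' : ℝ² → ℝ² → ℝ≥0∞} {Ω Ω' : Set ℝ²} {q : ℝ} {v w : ℝ² → ℝ}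

theorem mono (hw : IsHajlaszWeight d Ω q v w) (h : Ω' ⊆ Ω) : IsHajlaszWeight d Ω' q v w where
  measurable := hw.measurable
  nonneg := hw.nonneg
  integrableOn := hw.integrableOn.mono_set h
  sq_sub_le x hx y hy := hw.sq_sub_le x (h hx) y (h hy)

theorem of_le_mul (hw : IsHajlaszWeight d Ω q v w) (hq : 0 ≤ q) (K : ℝ≥0)
    (h : ∀ x ∈ Ω, ∀ y ∈ Ω, d x y ≤ K * d' x y) :
    IsHajlaszWeight d' Ω q v fun x => (K : ℝ) ^ q * w x where
  measurable := hw.measurable.const_mul _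
  nonneg x := mul_nonneg (by positivity) (hw.nonneg x)
  integrableOn := hw.integrableOn.const_mul _
  sq_sub_le x hx y hy hxy := by
    have hK : (K : ℝ≥0∞) * d' x y ≠ ⊤ := ENNReal.mul_ne_top ENNReal.coe_ne_top hxy
    have hd : (d x y).toReal ≤ K * (d' x y).toReal := by
      simpa using ENNReal.toReal_mono hK (h x hx y hy)
    have hwxy := add_nonneg (hw.nonneg x) (hw.nonneg y)
    calc (v x - v y) ^ 2 ≤ (w x + w y) * (d x y).toReal ^ q :=
          hw.sq_sub_le x hx y hy (ne_top_of_le_ne_top hK (h x hx y hy))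
      _ ≤ (w x + w y) * (K * (d' x y).toReal) ^ q := by gcongr
      _ = (K ^ q * w x + K ^ q * w y) * (d' x y).toReal ^ q := by
        rw [Real.mul_rpow K.coe_nonneg ENNReal.toReal_nonneg]
        ring

end IsHajlaszWeight

theorem enorm_sq_div_rpow_le {δ : ℝ≥0∞} {t a q B ρ : ℝ} (ha : 0 ≤ a) (hq : 0 < q) (hρ : 0 < ρ)
    (hρδ : ENNReal.ofReal ρ ≤ δ) (h : δ ≠ ⊤ → t ^ 2 ≤ B * δ.toReal ^ q) :
    ‖t‖ₑ ^ 2 / δ ^ (a + q) ≤ ENNReal.ofReal (B * ρ ^ (-a)) := by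
  rcases eq_or_ne δ ⊤ with rfl | hδ
  · simp [ENNReal.top_rpow_of_pos (by positivity : 0 < a + q)]
  specialize h hδ
  lift δ to ℝ≥0 using hδ
  have hρδ' : ρ ≤ δ := by simpa using hρδ
  have hδ : 0 < (δ : ℝ) := hρ.trans_le hρδ'
  rw [ENNReal.coe_toReal] at h
  have hB : 0 ≤ B * δ ^ q := (sq_nonneg t).trans h
  rw [Real.enorm_eq_ofReal_abs, ← ENNReal.ofReal_pow (abs_nonneg t), sq_abs,
    ← ENNReal.ofReal_coe_nnreal, ENNReal.ofReal_rpow_of_pos hδ,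
    ← ENNReal.ofReal_div_of_pos (by positivity)]
  refine ENNReal.ofReal_le_ofReal ?_
  rw [div_le_iff₀ (by positivity), Real.rpow_neg hρ.le, Real.rpow_add hδ]
  calc t ^ 2 ≤ B * δ ^ q := h
    _ ≤ B * δ ^ q * ((ρ ^ a)⁻¹ * δ ^ a) := by
      refine le_mul_of_one_le_right hB ?_
      rw [inv_mul_eq_div, one_le_div (by positivity)]
      gcongr
    _ = B * (ρ ^ a)⁻¹ * (δ ^ a * δ ^ q) := by ring

theorem IsHajlaszWeight.slobodeckijSq_lt_top {d : ℝ² → ℝ² → ℝ≥0∞} {Ω : Set ℝ²} {q σ : ℝ}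
    {v w : ℝ² → ℝ} (hw : IsHajlaszWeight d Ω q v w) (hΩ : MeasurableSet Ω)
    (hb : Bornology.IsBounded Ω) (hd : ∀ x ∈ Ω, ∀ y ∈ Ω, edist x y ≤ d x y) (hσ : 0 ≤ σ)
    (hσq : 2 * σ < q) (hq : q ≤ 2) : slobodeckijSq d Ω σ v < ⊤ := by
  set a : ℝ := 2 + 2 * σ - q with ha
  set κ : ℝ² → ℝ≥0∞ := fun z => ENNReal.ofReal (‖z‖ ^ (-a))
  set W : ℝ² → ℝ≥0∞ := fun x => ENNReal.ofReal (w x)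
  have hκ : Measurable κ := (measurable_norm.pow_const _).ennreal_ofReal
  have hkernel : ∫⁻ z in Ω - Ω, κ z < ⊤ :=
    (integrableOn_norm_rpow (hb.sub hb) (by simp; linarith)).lintegral_lt_top
  have pointwise : ∀ x ∈ Ω, ∀ y ∈ Ω,
      ‖v x - v y‖ₑ ^ 2 / d x y ^ (2 + 2 * σ) ≤ (W x + W y) * κ (x - y) := fun x hx y hy => by
    rcases eq_or_ne x y with rfl | hxy
    · simp
    rw [← ENNReal.ofReal_add (hw.nonneg x) (hw.nonneg y),
      ← ENNReal.ofReal_mul (add_nonneg (hw.nonneg x) (hw.nonneg y)),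
      show 2 + 2 * σ = a + q by rw [ha]; ring]
    refine enorm_sq_div_rpow_le (by linarith) (by linarith) (norm_pos_iff.2 (sub_ne_zero.2 hxy)) ?_
      (hw.sq_sub_le x hx y hy)
    rw [← dist_eq_norm, ← edist_dist]
    exact hd x hx y hy
  calc slobodeckijSq d Ω σ v ≤ ∫⁻ x in Ω, ∫⁻ y in Ω, (W x + W y) * κ (x - y) :=
        setLIntegral_mono' hΩ fun x hx => setLIntegral_mono' hΩ (pointwise x hx)
    _ ≤ 2 * ((∫⁻ x in Ω, W x) * ∫⁻ z in Ω - Ω, κ z) :=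
        lintegral_lintegral_add_mul_sub_le hΩ hw.measurable.ennreal_ofReal hκ
          fun z => by simp only [κ, norm_neg]
    _ < ⊤ := ENNReal.mul_lt_top ENNReal.ofNat_lt_top
        (ENNReal.mul_lt_top hw.integrableOn.lintegral_lt_top hkernel)

end HajlaszWeights

section InnerDistance

theorem edist_le_mul_eVariationOn {E F : Type*} [NormedAddCommGroup E] [NormedSpace ℝ E]
    [NormedAddCommGroup F] [NormedSpace ℝ F] {U : Set E} (hU : IsOpen U) {v : E → F}
    (hv : ∀ z ∈ U, DifferentiableAt ℝ v z) {L : ℝ≥0} (hL : ∀ z ∈ U, ‖fderiv ℝ v z‖₊ ≤ L) {x y : E}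
    (γ : Path x y) (hγ : ∀ t, γ t ∈ U) : edist (v x) (v y) ≤ L * eVariationOn γ univ := by
  let ι := {p : E × ℝ // ball p.1 p.2 ⊆ U}
  obtain ⟨t, ht0, htm, ⟨n, hn⟩, ht⟩ := exists_monotone_Icc_subset_open_cover_unitInterval
    (c := fun p : ι => γ ⁻¹' ball p.1.1 p.1.2)
    (fun p => isOpen_ball.preimage γ.continuous) (fun s _ => by
      obtain ⟨ε, hε, hsub⟩ := isOpen_iff.1 hU (γ s) (hγ s)
      exact mem_iUnion.2 ⟨⟨(γ s, ε), hsub⟩, mem_ball_self hε⟩)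
  have step (i : ℕ) : edist (v (γ (t i))) (v (γ (t (i + 1)))) ≤
      L * edist (γ (t (i + 1))) (γ (t i)) := by
    obtain ⟨p, hp⟩ := ht i
    have hlip : LipschitzOnWith L v (ball p.1.1 p.1.2) :=
      (convex_ball _ _).lipschitzOnWith_of_nnnorm_fderiv_le
        (fun z hz => hv z (p.2 hz)) (fun z hz => hL z (p.2 hz))
    rw [edist_comm (γ (t (i + 1)))]
    exact hlip (hp ⟨le_rfl, htm (Nat.le_succ i)⟩) (hp ⟨htm (Nat.le_succ i), le_rfl⟩)
  calc edist (v x) (v y) = edist (v (γ (t 0))) (v (γ (t n))) := by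
        rw [ht0, hn n le_rfl, γ.source, γ.target]
    _ ≤ ∑ i ∈ Finset.range n, edist (v (γ (t i))) (v (γ (t (i + 1)))) :=
      edist_le_range_sum_edist (fun i => v (γ (t i))) n
    _ ≤ ∑ i ∈ Finset.range n, L * edist (γ (t (i + 1))) (γ (t i)) :=
      Finset.sum_le_sum fun i _ => step i
    _ = L * ∑ i ∈ Finset.range n, edist (γ (t (i + 1))) (γ (t i)) := by rw [Finset.mul_sum]
    _ ≤ L * eVariationOn γ univ := by
      gcongr
      exact eVariationOn.sum_le htm fun _ => mem_univ _

variable {Ω : Set ℝ²} {v : ℝ² → ℝ} {x y : ℝ²}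

theorem edist_le_innerEDist (Ω : Set ℝ²) (x y : ℝ²) : edist x y ≤ innerEDist Ω x y :=
  le_iInf₂ fun γ _ => by
    simpa only [γ.source, γ.target] using eVariationOn.edist_le γ (mem_univ 0) (mem_univ 1)

theorem edist_le_mul_innerEDist_of_lt (hΩ : IsOpen Ω) (hv : ∀ z ∈ Ω, DifferentiableAt ℝ v z)
    {r : ℝ≥0∞} {L : ℝ≥0} (hL : ∀ z ∈ Ω, edist x z < r → ‖fderiv ℝ v z‖₊ ≤ L)
    (hxy : innerEDist Ω x y < r) : edist (v x) (v y) ≤ L * innerEDist Ω x y := by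
  by_contra! hlt
  have hlt' : innerEDist Ω x y < edist (v x) (v y) / L := by
    rwa [ENNReal.lt_div_iff_mul_lt (.inr hxy.ne_top) (.inl ENNReal.coe_ne_top), mul_comm]
  obtain ⟨γ, hγΩ, hγ⟩ : ∃ (γ : Path x y) (_ : ∀ t, γ t ∈ Ω),
      eVariationOn γ univ < min r (edist (v x) (v y) / L) := by
    simpa only [innerEDist, iInf_lt_iff] using lt_min hxy hlt'
  have hball (t) : edist x (γ t) < r := by
    refine lt_of_le_of_lt ?_ (lt_min_iff.1 hγ).1
    simpa only [γ.source] using eVariationOn.edist_le γ (mem_univ 0) (mem_univ t)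
  have hle : edist (v x) (v y) ≤ L * eVariationOn γ univ :=
    edist_le_mul_eVariationOn (U := Ω ∩ {z | edist x z < r})
      (hΩ.inter (isOpen_lt (by fun_prop) continuous_const)) (fun z hz => hv z hz.1)
      (fun z hz => hL z hz.1 hz.2) γ fun t => ⟨hγΩ t, hball t⟩
  refine hle.not_gt ?_
  rw [mul_comm, ← ENNReal.lt_div_iff_mul_lt (.inr hγ.ne_top) (.inl ENNReal.coe_ne_top)]
  exact (lt_min_iff.1 hγ).2

theorem innerEDist_le_of_lipschitzOnWith {γ : ℝ → ℝ²} {K : ℝ≥0}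
    (hγ : LipschitzOnWith K γ (Icc 0 1)) (hΩ : ∀ t ∈ Icc (0 : ℝ) 1, γ t ∈ Ω) :
    innerEDist Ω (γ 0) (γ 1) ≤ K := by
  let p : Path (γ 0) (γ 1) :=
    { toFun := fun t : unitInterval => γ t
      continuous_toFun := hγ.continuousOn.comp_continuous continuous_subtype_val fun t => t.2
      source' := by simp
      target' := by simp }
  have hvar : eVariationOn (id : ℝ → ℝ) (Icc 0 1) = 1 := by
    have := (monotone_id.monotoneOn (Icc (0 : ℝ) 1)).eVariationOn_eq
      (left_mem_Icc.2 zero_le_one) (right_mem_Icc.2 zero_le_one)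
    simpa only [id, sub_zero, ENNReal.ofReal_one, inter_self] using this
  calc innerEDist Ω (γ 0) (γ 1) ≤ eVariationOn p univ := iInf₂_le p fun t => hΩ _ t.2
    _ = eVariationOn γ (Icc 0 1) := by
      have := eVariationOn.comp_eq_of_monotoneOn γ ((↑) : unitInterval → ℝ) (t := univ)
        fun _ _ _ _ h => h
      rwa [image_univ, Subtype.range_coe] at this
    _ ≤ K * eVariationOn (id : ℝ → ℝ) (Icc 0 1) := hγ.comp_eVariationOn_le (mapsTo_id _)
    _ = K := by rw [hvar, mul_one]

theorem innerEDist_eq_edist_of_segment_subset (h : segment ℝ x y ⊆ Ω) :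
    innerEDist Ω x y = edist x y := by
  refine le_antisymm ?_ (edist_le_innerEDist Ω x y)
  have hle := innerEDist_le_of_lipschitzOnWith (Ω := Ω) (γ := AffineMap.lineMap (k := ℝ) x y)
    (lipschitzWith_lineMap x y).lipschitzOnWith fun t ht => h (by
      rw [segment_eq_image_lineMap]
      exact mem_image_of_mem _ ht)
  rwa [AffineMap.lineMap_apply_zero, AffineMap.lineMap_apply_one, ← edist_nndist] at hle

end InnerDistance

section PowerGrowth

theorem sq_le_of_abs_le_rpow_mul {V L b q δ r : ℝ} (hq : 0 ≤ q) (hq' : q ≤ 2) (hr : 0 < r)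
    (hδ : 0 ≤ δ) (hδr : δ ≤ r) (hV : |V| ≤ L * r ^ (b - 1) * δ) :
    V ^ 2 ≤ L ^ 2 * r ^ (2 * b - q) * δ ^ q := by
  calc V ^ 2 = |V| ^ 2 := (sq_abs V).symm
    _ ≤ (L * r ^ (b - 1) * δ) ^ 2 := by gcongr
    _ = L ^ 2 * r ^ (2 * (b - 1)) * (δ ^ (2 - q) * δ ^ q) := by
      rw [← Real.rpow_add_of_nonneg hδ (by linarith) hq, sub_add_cancel, Real.rpow_two,
        mul_comm 2 (b - 1), Real.rpow_mul hr.le, Real.rpow_two]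
      ring
    _ ≤ L ^ 2 * r ^ (2 * (b - 1)) * (r ^ (2 - q) * δ ^ q) := by
      gcongr
    _ = L ^ 2 * r ^ (2 * b - q) * δ ^ q := by
      rw [show 2 * b - q = 2 * (b - 1) + (2 - q) by ring, Real.rpow_add hr]
      ring

theorem sq_le_of_abs_le_add {V C b q δ r r' A A' : ℝ} (hq : 0 ≤ q) (hr : 0 ≤ r) (hr' : 0 ≤ r')
    (hA : 0 < A) (hA' : 0 < A') (hAδ : A ≤ 3 * δ) (hAδ' : A' ≤ 3 * δ)
    (hV : |V| ≤ C * r ^ b + C * r' ^ b) :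
    V ^ 2 ≤ 2 * C ^ 2 * 3 ^ q * (r ^ (2 * b) * A ^ (-q) + r' ^ (2 * b) * A' ^ (-q)) * δ ^ q := by
  have hδ : 0 ≤ δ := by linarith
  have one_le {B : ℝ} (hB : 0 < B) (hBδ : B ≤ 3 * δ) : 1 ≤ B ^ (-q) * (3 ^ q * δ ^ q) := by
    rw [Real.rpow_neg hB.le, inv_mul_eq_div, one_le_div (by positivity),
      ← Real.mul_rpow (by norm_num) hδ]
    gcongr
  have hsq {t : ℝ} (ht : 0 ≤ t) : (t ^ b) ^ 2 = t ^ (2 * b) := by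
    rw [mul_comm, Real.rpow_mul ht, Real.rpow_two]
  calc V ^ 2 = |V| ^ 2 := (sq_abs V).symm
    _ ≤ (C * r ^ b + C * r' ^ b) ^ 2 := by gcongr
    _ ≤ 2 * ((C * r ^ b) ^ 2 + (C * r' ^ b) ^ 2) := add_sq_le
    _ = 2 * C ^ 2 * (r ^ (2 * b) + r' ^ (2 * b)) := by rw [mul_pow, mul_pow, hsq hr, hsq hr']; ring
    _ ≤ 2 * C ^ 2 * (r ^ (2 * b) * (A ^ (-q) * (3 ^ q * δ ^ q)) +
          r' ^ (2 * b) * (A' ^ (-q) * (3 ^ q * δ ^ q))) := by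
      gcongr
      · exact le_mul_of_one_le_right (by positivity) (one_le hA hAδ)
      · exact le_mul_of_one_le_right (by positivity) (one_le hA' hAδ')
    _ = 2 * C ^ 2 * 3 ^ q * (r ^ (2 * b) * A ^ (-q) + r' ^ (2 * b) * A' ^ (-q)) * δ ^ q := by ring

variable {Ω : Set ℝ²} {v : ℝ² → ℝ} {C b q : ℝ}

-- Each path realizing a length below `‖x‖ / 2` stays where the gradient is `O(‖x‖ ^ (b - 1))`.
theorem abs_sub_le_of_innerEDist_lt (hΩ : IsOpen Ω) (hv : ∀ z ∈ Ω, DifferentiableAt ℝ v z)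
    (hb : b ≤ 1) (hC : 0 ≤ C) (h : ∀ z ∈ Ω, ‖fderiv ℝ v z‖ ≤ C * ‖z‖ ^ (b - 1)) {x y : ℝ²}
    (hx : 0 < ‖x‖) (hxy : innerEDist Ω x y < ENNReal.ofReal (‖x‖ / 2)) :
    |v x - v y| ≤ C * (1 / 2) ^ (b - 1) * ‖x‖ ^ (b - 1) * (innerEDist Ω x y).toReal := by
  let L : ℝ≥0 := ⟨C * (1 / 2) ^ (b - 1) * ‖x‖ ^ (b - 1), by positivity⟩
  have hL (z) (hz : z ∈ Ω) (hxz : edist x z < ENNReal.ofReal (‖x‖ / 2)) :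
      ‖fderiv ℝ v z‖₊ ≤ L := by
    have hnorm : 1 / 2 * ‖x‖ ≤ ‖z‖ := by
      rw [edist_dist, ENNReal.ofReal_lt_ofReal_iff (by positivity), dist_eq_norm] at hxz
      linarith [norm_sub_norm_le x z]
    calc ‖fderiv ℝ v z‖ ≤ C * ‖z‖ ^ (b - 1) := h z hz
      _ ≤ C * (1 / 2 * ‖x‖) ^ (b - 1) := mul_le_mul_of_nonneg_left
        (Real.rpow_le_rpow_of_nonpos (by positivity) hnorm (by linarith)) hC
      _ = C * (1 / 2) ^ (b - 1) * ‖x‖ ^ (b - 1) := by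
        rw [Real.mul_rpow (by norm_num) hx.le, mul_assoc]
  have hlip := ENNReal.toReal_mono (ENNReal.mul_ne_top ENNReal.coe_ne_top hxy.ne_top)
    (edist_le_mul_innerEDist_of_lt hΩ hv hL hxy)
  rwa [ENNReal.toReal_mul, edist_dist, ENNReal.toReal_ofReal dist_nonneg, Real.dist_eq] at hlip

theorem isHajlaszWeight_innerEDist (hΩ : IsOpen Ω) (hΩb : Bornology.IsBounded Ω) (hΩ0 : 0 ∉ Ω)
    (hv : ∀ z ∈ Ω, DifferentiableAt ℝ v z) (hb : b ≤ 1) (h0 : ∀ z ∈ Ω, |v z| ≤ C * ‖z‖ ^ b)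
    (h1 : ∀ z ∈ Ω, ‖fderiv ℝ v z‖ ≤ C * ‖z‖ ^ (b - 1)) (hq : 0 ≤ q) (hq' : q ≤ 2)
    (hqb : -2 < 2 * b - q) :
    IsHajlaszWeight (innerEDist Ω) Ω q v fun x =>
      (2 * C ^ 2 * 3 ^ q + (C * (1 / 2) ^ (b - 1)) ^ 2) * ‖x‖ ^ (2 * b - q) where
  measurable := (measurable_norm.pow_const _).const_mul _
  nonneg x := by positivity
  integrableOn := (integrableOn_norm_rpow hΩb (by simpa using hqb)).const_mul _
  sq_sub_le x hx y hy hxy := by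
    have norm_pos {z : ℝ²} (hz : z ∈ Ω) : 0 < ‖z‖ := norm_pos_iff.2 (ne_of_mem_of_not_mem hz hΩ0)
    have hC : 0 ≤ C := nonneg_of_mul_nonneg_left ((abs_nonneg _).trans (h0 x hx))
      (Real.rpow_pos_of_pos (norm_pos hx) b)
    set δ := (innerEDist Ω x y).toReal
    have hδ : 0 ≤ δ := ENNReal.toReal_nonneg
    rw [← mul_add]
    rcases lt_or_ge δ (‖x‖ / 2) with hnear | hfar
    · have hxy' := (ENNReal.lt_ofReal_iff_toReal_lt hxy).2 hnear
      refine (sq_le_of_abs_le_rpow_mul hq hq' (norm_pos hx) hδ (by linarith)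
        (abs_sub_le_of_innerEDist_lt hΩ hv hb hC h1 (norm_pos hx) hxy')).trans ?_
      gcongr
      · exact le_add_of_nonneg_left (by positivity)
      · exact le_add_of_nonneg_right (by positivity)
    · have hdist : ‖x - y‖ ≤ δ := by
        rw [← dist_eq_norm, dist_edist]
        exact ENNReal.toReal_mono hxy (edist_le_innerEDist Ω x y)
      have hy3 : ‖y‖ ≤ 3 * δ := by linarith [norm_sub_norm_le y x, norm_sub_rev x y]
      have hfar' := sq_le_of_abs_le_add hq (norm_nonneg x) (norm_nonneg y) (norm_pos hx)
        (norm_pos hy) (by linarith) hy3 ((abs_sub _ _).trans (add_le_add (h0 x hx) (h0 y hy)))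
      rw [← Real.rpow_add (norm_pos hx), ← Real.rpow_add (norm_pos hy), ← sub_eq_add_neg] at hfar'
      refine hfar'.trans ?_
      gcongr
      exact le_add_of_nonneg_right (by positivity)

end PowerGrowth

section SlitDomain

open scoped ContDiff

/-- The isometric identification of the Euclidean plane with `ℂ`. -/
def toComplex : ℝ² ≃ₗᵢ[ℝ] ℂ :=
  Complex.orthonormalBasisOneI.repr.symm

theorem toComplex_apply (x : ℝ²) : toComplex x = x 0 + x 1 * Complex.I :=
  Complex.orthonormalBasisOneI_repr_symm_apply x

/-- The plane cut along the nonnegative real axis, the domain of the powers `branchPow`. Negation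
turns it into Mathlib's `Complex.slitPlane`, which is cut along the nonpositive axis. -/
def slitDomain : Set ℝ² :=
  {x | -toComplex x ∈ Complex.slitPlane}

variable {x : ℝ²}

theorem isOpen_slitDomain : IsOpen slitDomain :=
  Complex.isOpen_slitPlane.preimage toComplex.continuous.neg

theorem mem_slitDomain_iff : x ∈ slitDomain ↔ x 0 < 0 ∨ x 1 ≠ 0 := by
  change -toComplex x ∈ Complex.slitPlane ↔ _
  simp [Complex.mem_slitPlane_iff, toComplex_apply]

theorem zero_notMem_slitDomain : (0 : ℝ²) ∉ slitDomain := by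
  simp [mem_slitDomain_iff]

theorem norm_pos_of_mem_slitDomain (hx : x ∈ slitDomain) : 0 < ‖x‖ :=
  norm_pos_iff.2 (ne_of_mem_of_not_mem hx zero_notMem_slitDomain)

/-- The power `z ^ β`, with the branch `arg z ∈ (0, 2π)`. -/
def branchPow (β : ℝ) (x : ℝ²) : ℂ :=
  Complex.exp (β * (Complex.log (-toComplex x) + Real.pi * Complex.I))

theorem norm_branchPow (β : ℝ) (hx : x ∈ slitDomain) : ‖branchPow β x‖ = ‖x‖ ^ β := by
  rw [branchPow, Complex.norm_exp, Real.rpow_def_of_pos (norm_pos_of_mem_slitDomain hx)]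
  simp [Complex.log_re, toComplex.norm_map, mul_comm]

theorem branchPow_re (β : ℝ) (hx : x ∈ slitDomain) :
    (branchPow β x).re = ‖x‖ ^ β * Real.cos (β * (Complex.arg (-toComplex x) + Real.pi)) := by
  rw [branchPow, Complex.exp_re, Real.rpow_def_of_pos (norm_pos_of_mem_slitDomain hx)]
  simp [Complex.log_re, Complex.log_im, toComplex.norm_map, mul_comm]

theorem branchPow_sub_one_mul (β : ℝ) (hx : x ∈ slitDomain) :
    branchPow (β - 1) x * toComplex x = branchPow β x := by
  have hexp : Complex.exp (Complex.log (-toComplex x) + Real.pi * Complex.I) = toComplex x := by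
    rw [Complex.exp_add, Complex.exp_log (Complex.slitPlane_ne_zero hx), Complex.exp_pi_mul_I,
      mul_neg_one, neg_neg]
  conv_lhs => rw [← hexp]
  rw [branchPow, branchPow, ← Complex.exp_add]
  push_cast
  ring_nf

theorem branchPow_natCast (n : ℕ) (hx : x ∈ slitDomain) : branchPow n x = toComplex x ^ n := by
  induction n with
  | zero => simp [branchPow]
  | succ n ih =>
    rw [← branchPow_sub_one_mul _ hx, Nat.cast_succ, add_sub_cancel_right, ih, pow_succ]

theorem hasFDerivAt_branchPow (β : ℝ) (hx : x ∈ slitDomain) :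
    HasFDerivAt (branchPow β) ((β * branchPow (β - 1) x) •
      (toComplex.toContinuousLinearEquiv : ℝ² →L[ℝ] ℂ)) x := by
  have hz : toComplex x ≠ 0 := neg_ne_zero.1 (Complex.slitPlane_ne_zero hx)
  have hderiv : HasDerivAt
      (fun z : ℂ => Complex.exp (β * (Complex.log (-z) + Real.pi * Complex.I)))
      (β * branchPow (β - 1) x) (toComplex x) := by
    refine ((((hasDerivAt_neg _).clog hx).add_const _).const_mul (β : ℂ)).cexp.congr_deriv ?_
    change branchPow β x * _ = _
    rw [← branchPow_sub_one_mul β hx]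
    field_simp
  exact hderiv.comp_hasFDerivAt x toComplex.toContinuousLinearEquiv.hasFDerivAt

theorem contDiffOn_branchPow (β : ℝ) : ContDiffOn ℝ ∞ (branchPow β) slitDomain := fun x hx => by
  have hlog : ContDiffAt ℝ ∞ (fun y => Complex.log (-toComplex y)) x :=
    ((Complex.contDiffAt_log hx).restrict_scalars ℝ).comp x toComplex.contDiff.neg.contDiffAt
  exact (contDiffAt_const.mul (hlog.add contDiffAt_const)).cexp.contDiffWithinAt

end SlitDomain

section PowerModes

open scoped ContDiff

/-- The real part of `z ^ β H`. These functions are stable under partial derivatives, each of which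
lowers `β` by one, and the eigenmode is one of them. -/
def powMode (β : ℝ) (H : ℝ² → ℂ) (x : ℝ²) : ℝ :=
  (branchPow β x * H x).re

variable {β : ℝ} {H : ℝ² → ℂ}

theorem contDiffOn_powMode (β : ℝ) (hH : ContDiff ℝ ∞ H) :
    ContDiffOn ℝ ∞ (powMode β H) slitDomain :=
  Complex.reCLM.contDiff.comp_contDiffOn ((contDiffOn_branchPow β).mul hH.contDiffOn)

theorem exists_partialDeriv_powMode (i : Fin 2) (β : ℝ) (hH : ContDiff ℝ ∞ H) :
    ∃ H' : ℝ² → ℂ, ContDiff ℝ ∞ H' ∧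
      EqOn (partialDeriv i (powMode β H)) (powMode (β - 1) H') slitDomain := by
  let e : ℝ² := EuclideanSpace.single i 1
  refine ⟨fun x => toComplex x * fderiv ℝ H x e + β * toComplex e * H x, ?_, fun x hx => ?_⟩
  · exact (toComplex.contDiff.mul ((hH.fderiv_right (m := ∞) (by simp)).clm_apply
      contDiff_const)).add (contDiff_const.mul hH)
  · have hprod : HasFDerivAt (powMode β H) _ x := Complex.reCLM.hasFDerivAt.comp x
      ((hasFDerivAt_branchPow β hx).mul (hH.differentiable (by simp) x).hasFDerivAt)
    rw [partialDeriv, hprod.fderiv]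
    change (branchPow β x * fderiv ℝ H x e + H x * (β * branchPow (β - 1) x * toComplex e)).re = _
    rw [powMode, ← branchPow_sub_one_mul β hx]
    ring_nf

theorem exists_multiDeriv_powMode (α : Fin 2 → ℕ) (β : ℝ) (hH : ContDiff ℝ ∞ H) :
    ∃ H' : ℝ² → ℂ, ContDiff ℝ ∞ H' ∧
      EqOn (multiDeriv α (powMode β H)) (powMode (β - (α 0 + α 1 : ℕ)) H') slitDomain := by
  refine multiDeriv_induction (P := fun n g => ∃ H' : ℝ² → ℂ, ContDiff ℝ ∞ H' ∧
    EqOn g (powMode (β - n) H') slitDomain) (fun i n g => ?_) α ⟨H, hH, fun x _ => by simp⟩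
  rintro ⟨H₁, hH₁, h₁⟩
  obtain ⟨H₂, hH₂, h₂⟩ := exists_partialDeriv_powMode i (β - n) hH₁
  refine ⟨H₂, hH₂, ((partialDeriv_congr isOpen_slitDomain i h₁).trans h₂).trans fun x _ => ?_⟩
  rw [Nat.cast_succ, sub_sub]

variable {Ω : Set ℝ²} {b : ℝ}

theorem exists_abs_powMode_le (hΩ : Ω ⊆ slitDomain) (hΩb : Bornology.IsBounded Ω) (hb : b ≤ β)
    (hH : Continuous H) : ∃ C, 0 ≤ C ∧ ∀ x ∈ Ω, |powMode β H x| ≤ C * ‖x‖ ^ b := by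
  obtain ⟨R, hR, hΩR⟩ := hΩb.subset_closedBall_lt 0 0
  obtain ⟨A, hA⟩ := (isCompact_closedBall (0 : ℝ²) R).exists_bound_of_continuousOn hH.continuousOn
  have hA0 : 0 ≤ A := (norm_nonneg _).trans (hA 0 (mem_closedBall_self hR.le))
  refine ⟨R ^ (β - b) * A, by positivity, fun x hx => ?_⟩
  have hxR := mem_closedBall_zero_iff.1 (hΩR hx)
  calc |powMode β H x| ≤ ‖branchPow β x * H x‖ := Complex.abs_re_le_norm _
    _ = ‖x‖ ^ (β - b) * ‖x‖ ^ b * ‖H x‖ := by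
      rw [norm_mul, norm_branchPow β (hΩ hx), ← Real.rpow_add (norm_pos_of_mem_slitDomain (hΩ hx)),
        sub_add_cancel]
    _ ≤ R ^ (β - b) * ‖x‖ ^ b * A := by
      gcongr
      exact hA x (hΩR hx)
    _ = R ^ (β - b) * A * ‖x‖ ^ b := by ring

theorem exists_norm_fderiv_powMode_le (hΩ : Ω ⊆ slitDomain) (hΩb : Bornology.IsBounded Ω)
    (hb : b ≤ β) (hH : ContDiff ℝ ∞ H) :
    ∃ C, 0 ≤ C ∧ ∀ x ∈ Ω, ‖fderiv ℝ (powMode β H) x‖ ≤ C * ‖x‖ ^ (b - 1) := by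
  have bound (i : Fin 2) : ∃ C, 0 ≤ C ∧
      ∀ x ∈ Ω, |partialDeriv i (powMode β H) x| ≤ C * ‖x‖ ^ (b - 1) := by
    obtain ⟨H', hH', hEq⟩ := exists_partialDeriv_powMode i β hH
    obtain ⟨C, hC, h⟩ := exists_abs_powMode_le hΩ hΩb (sub_le_sub_right hb 1) hH'.continuous
    exact ⟨C, hC, fun x hx => by rw [hEq (hΩ hx)]; exact h x hx⟩
  obtain ⟨C₀, hC₀, h₀⟩ := bound 0
  obtain ⟨C₁, hC₁, h₁⟩ := bound 1
  refine ⟨C₀ + C₁, add_nonneg hC₀ hC₁, fun x hx => ?_⟩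
  rw [add_mul]
  exact (norm_fderiv_le_add_abs_partialDeriv _ x).trans (add_le_add (h₀ x hx) (h₁ x hx))

theorem exists_powMode_growth (hΩ : Ω ⊆ slitDomain) (hΩb : Bornology.IsBounded Ω) (hb : b ≤ β)
    (hH : ContDiff ℝ ∞ H) : ∃ C, (∀ x ∈ Ω, |powMode β H x| ≤ C * ‖x‖ ^ b) ∧
      ∀ x ∈ Ω, ‖fderiv ℝ (powMode β H) x‖ ≤ C * ‖x‖ ^ (b - 1) := by
  obtain ⟨C, hC, h⟩ := exists_abs_powMode_le hΩ hΩb hb hH.continuous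
  obtain ⟨C', hC', h'⟩ := exists_norm_fderiv_powMode_le hΩ hΩb hb hH
  refine ⟨C + C', fun x hx => (h x hx).trans ?_, fun x hx => (h' x hx).trans ?_⟩ <;> gcongr
  · exact le_add_of_nonneg_right hC'
  · exact le_add_of_nonneg_left hC

theorem differentiableAt_powMode (β : ℝ) (hH : ContDiff ℝ ∞ H) {x : ℝ²} (hx : x ∈ slitDomain) :
    DifferentiableAt ℝ (powMode β H) x :=
  ((contDiffOn_powMode β hH).contDiffAt (isOpen_slitDomain.mem_nhds hx)).differentiableAt (by simp)

end PowerModes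

section SlitWeights

theorem segment_subset_slitDomain {x y : ℝ²} (hx : x ∈ slitDomain) (hy : y ∈ slitDomain)
    (h : 0 ≤ x 1 * y 1) : segment ℝ x y ⊆ slitDomain := by
  rw [← openSegment_subset_iff_segment_subset hx hy]
  rintro _ ⟨s, t, hs, ht, -, rfl⟩
  rw [mem_slitDomain_iff] at hx hy ⊢
  simp only [PiLp.add_apply, PiLp.smul_apply, smul_eq_mul]
  by_cases hxy : x 1 = 0 ∧ y 1 = 0
  · have hx0 : x 0 < 0 := hx.resolve_right (not_not.2 hxy.1)
    have hy0 : y 0 < 0 := hy.resolve_right (not_not.2 hxy.2)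
    exact .inl (add_neg (mul_neg_of_pos_of_neg hs hx0) (mul_neg_of_pos_of_neg ht hy0))
  · have hpos : 0 < (s * x 1) ^ 2 + (t * y 1) ^ 2 := by
      rcases not_and_or.1 hxy with hx1 | hy1 <;> positivity
    refine .inr fun hzero => hpos.not_ge ?_
    calc (s * x 1) ^ 2 + (t * y 1) ^ 2
        ≤ (s * x 1) ^ 2 + (t * y 1) ^ 2 + 2 * (s * t) * (x 1 * y 1) :=
          le_add_of_nonneg_right (by positivity)
      _ = (s * x 1 + t * y 1) ^ 2 := by ring
      _ = 0 := by rw [hzero, zero_pow two_ne_zero]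
      _ ≤ 0 := le_rfl

theorem integrableOn_abs_rpow_mul_abs_rpow {s : Set ℝ²} (hs : Bornology.IsBounded s) {a c : ℝ}
    (ha : -1 < a) (hc : -1 < c) : IntegrableOn (fun x : ℝ² => |x 0| ^ a * |x 1| ^ c) s := by
  obtain ⟨R, hR⟩ := hs.subset_ball 0
  have hint {p : ℝ} (hp : -1 < p) : IntegrableOn (fun t : ℝ => |t| ^ p) (ball 0 R) :=
    integrableOn_norm_rpow isBounded_ball (by simpa using hp)
  have hprod : IntegrableOn (fun p : ℝ × ℝ => |p.1| ^ a * |p.2| ^ c) (ball 0 R ×ˢ ball 0 R) := by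
    rw [IntegrableOn, Measure.volume_eq_prod, ← Measure.prod_restrict]
    exact (hint ha).mul_prod (hint hc)
  have hpres := (volume_preserving_finTwoArrow ℝ).comp (PiLp.volume_preserving_ofLp (Fin 2))
  refine ((hpres.integrableOn_comp_preimage (MeasurableEquiv.finTwoArrow.measurableEmbedding.comp
    (MeasurableEquiv.toLp 2 (Fin 2 → ℝ)).symm.measurableEmbedding)).2 hprod).mono_set fun x hx => ?_
  have hcoord (i : Fin 2) : x i ∈ ball 0 R := mem_ball_zero_iff.2
    ((PiLp.norm_apply_le x i).trans_lt (mem_ball_zero_iff.1 (hR hx)))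
  exact ⟨hcoord 0, hcoord 1⟩

theorem integrableOn_norm_rpow_mul_abs_rpow {s : Set ℝ²} (hs : Bornology.IsBounded s) {p q : ℝ}
    (hp : p ≤ 0) (hq : -1 < q) (hpq : -2 < p + q) :
    IntegrableOn (fun x : ℝ² => ‖x‖ ^ p * |x 1| ^ q) s := by
  -- `‖x‖ ^ p = ‖x‖ ^ a * ‖x‖ ^ c` in the ratio `a : c` making both exponents below exceed `-1`.
  obtain ⟨a, c, ha, hc, ha1, hc1, rfl⟩ :
      ∃ a c : ℝ, a ≤ 0 ∧ c ≤ 0 ∧ -1 < a ∧ -1 < c + q ∧ p = a + c := by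
    have hq2 : 0 < 2 + q := by linarith
    have ha : -1 < p / (2 + q) := by rw [lt_div_iff₀ hq2]; linarith
    have ha0 : p / (2 + q) ≤ 0 := div_nonpos_of_nonpos_of_nonneg hp hq2.le
    refine ⟨p / (2 + q), p / (2 + q) * (1 + q), ha0, mul_nonpos_of_nonpos_of_nonneg ha0
      (by linarith), ha, ?_, by field_simp; ring⟩
    nlinarith
  have ne_zero (i : Fin 2) : ∀ᵐ x : ℝ², x i ≠ 0 :=
    (PiLp.volume_preserving_ofLp (Fin 2)).quasiMeasurePreserving.ae
      (Measure.ae_eval_ne (μ := fun _ : Fin 2 => (volume : Measure ℝ)) i 0)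
  have hm : Measurable fun x : ℝ² => x 1 := by fun_prop
  refine (integrableOn_abs_rpow_mul_abs_rpow hs ha1 hc1).mono'
    ((measurable_norm.pow_const _).mul (hm.abs.pow_const _)).aestronglyMeasurable
    (ae_restrict_of_ae ?_)
  filter_upwards [ne_zero 0, ne_zero 1] with x h0 h1
  rw [Real.norm_of_nonneg (by positivity),
    Real.rpow_add ((abs_pos.2 h0).trans_le (PiLp.norm_apply_le x 0)), Real.rpow_add (abs_pos.2 h1),
    ← mul_assoc]
  gcongr ?_ * ?_ * _
  · exact Real.rpow_le_rpow_of_nonpos (abs_pos.2 h0) (PiLp.norm_apply_le x 0) ha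
  · exact Real.rpow_le_rpow_of_nonpos (abs_pos.2 h1) (PiLp.norm_apply_le x 1) hc

-- Across the cut the jump of `v` is compared with `|x 1| + |y 1|` instead of `‖x‖ + ‖y‖`.
theorem isHajlaszWeight_edist_slitDomain {R C b q : ℝ} {v : ℝ² → ℝ}
    (hv : ∀ z ∈ slitDomain ∩ ball 0 R, DifferentiableAt ℝ v z) (hb : b ≤ 0)
    (h0 : ∀ z ∈ slitDomain ∩ ball 0 R, |v z| ≤ C * ‖z‖ ^ b)
    (h1 : ∀ z ∈ slitDomain ∩ ball 0 R, ‖fderiv ℝ v z‖ ≤ C * ‖z‖ ^ (b - 1)) (hq : 0 ≤ q)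
    (hq1 : q < 1) (hqb : -2 < 2 * b - q) :
    IsHajlaszWeight edist (slitDomain ∩ ball 0 R) q v fun x =>
      (2 * C ^ 2 * 3 ^ q + (C * (1 / 2) ^ (b - 1)) ^ 2) * ‖x‖ ^ (2 * b - q) +
        2 * C ^ 2 * 3 ^ q * (‖x‖ ^ (2 * b) * |x 1| ^ (-q)) := by
  have hbdd : Bornology.IsBounded (slitDomain ∩ ball 0 R) :=
    isBounded_ball.subset inter_subset_right
  have hinner := isHajlaszWeight_innerEDist (isOpen_slitDomain.inter isOpen_ball) hbdd
    (fun h => zero_notMem_slitDomain h.1) hv (by linarith) h0 h1 hq (by linarith) hqb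
  have hm : Measurable fun x : ℝ² => x 1 := by fun_prop
  refine ⟨hinner.measurable.add
    (((measurable_norm.pow_const _).mul (hm.abs.pow_const _)).const_mul _),
    fun x => by positivity, hinner.integrableOn.add ((integrableOn_norm_rpow_mul_abs_rpow hbdd
      (by linarith) (by linarith) (by linarith)).const_mul _), fun x hx y hy hxy => ?_⟩
  rcases le_or_gt 0 (x 1 * y 1) with hsame | hopposite
  · have heq := innerEDist_eq_edist_of_segment_subset (subset_inter
      (segment_subset_slitDomain hx.1 hy.1 hsame) ((convex_ball _ _).segment_subset hx.2 hy.2))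
    have hxy_inner := hinner.sq_sub_le x hx y hy (by rwa [heq])
    rw [heq] at hxy_inner
    refine hxy_inner.trans ?_
    gcongr <;> exact le_add_of_nonneg_right (by positivity)
  · rw [← dist_edist, dist_eq_norm]
    have hcoord : |x 1 - y 1| ≤ ‖x - y‖ := PiLp.norm_apply_le (x - y) 1
    have hx1 : |x 1| ≤ |x 1 - y 1| := sq_le_sq.1 (by nlinarith [sq_nonneg (y 1)])
    have hy1 : |y 1| ≤ |x 1 - y 1| := sq_le_sq.1 (by nlinarith [sq_nonneg (x 1)])
    refine (sq_le_of_abs_le_add (δ := ‖x - y‖) hq (norm_nonneg x) (norm_nonneg y)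
      (abs_pos.2 (left_ne_zero_of_mul hopposite.ne)) (abs_pos.2 (right_ne_zero_of_mul hopposite.ne))
      (by linarith [norm_nonneg (x - y)]) (by linarith [norm_nonneg (x - y)])
      ((abs_sub _ _).trans (add_le_add (h0 x hx) (h0 y hy)))).trans ?_
    rw [mul_add]
    gcongr <;> exact le_add_of_nonneg_left (by positivity)

theorem exists_isHajlaszWeight_of_contDiff {Ω : Set ℝ²} (hΩb : Bornology.IsBounded Ω) {v : ℝ² → ℝ}
    (hv : ContDiff ℝ 1 v) : ∃ w, IsHajlaszWeight edist Ω 2 v w := by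
  obtain ⟨R, hR⟩ := hΩb.subset_closedBall 0
  obtain ⟨L, hL⟩ := (isCompact_closedBall (0 : ℝ²) R).exists_bound_of_continuousOn
    (hv.continuous_fderiv one_ne_zero).continuousOn
  refine ⟨fun _ => L ^ 2, measurable_const, fun _ => sq_nonneg L,
    integrableOn_const hΩb.measure_lt_top.ne, fun x hx y hy _ => ?_⟩
  have hlip : |v x - v y| ≤ L * ‖x - y‖ :=
    (convex_closedBall (0 : ℝ²) R).norm_image_sub_le_of_norm_fderiv_le (𝕜 := ℝ)
      (fun z _ => hv.differentiable one_ne_zero z) hL (hR hy) (hR hx)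
  rw [← dist_edist, dist_eq_norm, Real.rpow_two]
  calc (v x - v y) ^ 2 = |v x - v y| ^ 2 := (sq_abs _).symm
    _ ≤ (L * ‖x - y‖) ^ 2 := by gcongr
    _ = L ^ 2 * ‖x - y‖ ^ 2 := mul_pow _ _ _
    _ ≤ (L ^ 2 + L ^ 2) * ‖x - y‖ ^ 2 := by
      gcongr
      exact le_add_of_nonneg_left (sq_nonneg L)

end SlitWeights

section Sector

/-- The point of the plane with polar coordinates `(r, φ)`. -/
def polar (r φ : ℝ) : ℝ² :=
  !₂[r * Real.cos φ, r * Real.sin φ]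

variable {r r' φ ψ ω : ℝ}

theorem toComplex_polar (r φ : ℝ) :
    toComplex (polar r φ) = r * (Complex.cos φ + Complex.sin φ * Complex.I) := by
  simp [toComplex_apply, polar]
  ring

theorem norm_polar (hr : 0 ≤ r) (φ : ℝ) : ‖polar r φ‖ = r := by
  rw [← toComplex.norm_map, toComplex_polar, norm_mul, Complex.norm_cos_add_sin_mul_I, mul_one,
    Complex.norm_real, Real.norm_of_nonneg hr]

theorem polar_norm_arg (x : ℝ²) : polar ‖x‖ (Complex.arg (-toComplex x) + Real.pi) = x := by
  apply toComplex.injective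
  have h := Complex.norm_mul_cos_add_sin_mul_I (-toComplex x)
  rw [norm_neg, toComplex.norm_map] at h
  rw [toComplex_polar]
  push_cast
  rw [Complex.cos_add_pi, Complex.sin_add_pi]
  linear_combination -h

theorem arg_neg_toComplex_polar (hr : 0 < r) (hφ : φ ∈ Ioo 0 (2 * Real.pi)) :
    Complex.arg (-toComplex (polar r φ)) = φ - Real.pi := by
  have hneg : -toComplex (polar r φ) =
      r * (Complex.cos (φ - Real.pi : ℝ) + Complex.sin (φ - Real.pi : ℝ) * Complex.I) := by
    rw [toComplex_polar]
    push_cast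
    rw [Complex.cos_sub_pi, Complex.sin_sub_pi]
    ring
  rw [hneg, Complex.arg_mul_cos_add_sin_mul_I hr]
  constructor <;> linarith [hφ.1, hφ.2]

theorem polar_mem_slitDomain (hr : 0 < r) (hφ : φ ∈ Ioo 0 (2 * Real.pi)) :
    polar r φ ∈ slitDomain := by
  change -toComplex _ ∈ Complex.slitPlane
  rw [Complex.mem_slitPlane_iff_arg, arg_neg_toComplex_polar hr hφ, neg_ne_zero,
    ← norm_ne_zero_iff, toComplex.norm_map, norm_polar hr.le]
  exact ⟨by linarith [hφ.2], hr.ne'⟩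

theorem arg_neg_toComplex_add_pi_mem_Ioo {x : ℝ²} (hx : x ∈ slitDomain) :
    Complex.arg (-toComplex x) + Real.pi ∈ Ioo 0 (2 * Real.pi) := by
  have hlt := (Complex.arg_le_pi (-toComplex x)).lt_of_ne (Complex.mem_slitPlane_iff_arg.1 hx).1
  constructor <;> linarith [Complex.neg_pi_lt_arg (-toComplex x)]

theorem sector_eq_image2_polar (ω : ℝ) : sector ω = image2 polar (Ioo 0 1) (Ioo 0 ω) := by
  ext x
  constructor
  · rintro ⟨r, φ, hr, hr1, hφ, hφω, rfl⟩
    exact ⟨r, ⟨hr, hr1⟩, φ, ⟨hφ, hφω⟩, rfl⟩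
  · rintro ⟨r, hr, φ, hφ, rfl⟩
    exact ⟨r, φ, hr.1, hr.2, hφ.1, hφ.2, rfl⟩

theorem sector_eq_inter (hω : ω ≤ 2 * Real.pi) :
    sector ω = slitDomain ∩ (fun x => Complex.arg (-toComplex x) + Real.pi) ⁻¹' Iio ω ∩
      ball 0 1 := by
  ext x
  rw [mem_inter_iff, mem_ball_zero_iff]
  constructor
  · rw [sector_eq_image2_polar]
    rintro ⟨r, hr, φ, hφ, rfl⟩
    have hφ' : φ ∈ Ioo 0 (2 * Real.pi) := ⟨hφ.1, hφ.2.trans_le hω⟩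
    refine ⟨⟨polar_mem_slitDomain hr.1 hφ', ?_⟩, (norm_polar hr.1.le φ).trans_lt hr.2⟩
    rw [mem_preimage, arg_neg_toComplex_polar hr.1 hφ', sub_add_cancel]
    exact hφ.2
  · rintro ⟨⟨hx, harg⟩, hnorm⟩
    rw [sector_eq_image2_polar]
    exact ⟨_, ⟨norm_pos_of_mem_slitDomain hx, hnorm⟩, _,
      ⟨(arg_neg_toComplex_add_pi_mem_Ioo hx).1, harg⟩, polar_norm_arg x⟩

theorem sector_subset_slitDomain (hω : ω ≤ 2 * Real.pi) : sector ω ⊆ slitDomain := by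
  rw [sector_eq_inter hω]
  exact inter_subset_left.trans inter_subset_left

theorem isBounded_sector (hω : ω ≤ 2 * Real.pi) : Bornology.IsBounded (sector ω) := by
  rw [sector_eq_inter hω]
  exact isBounded_ball.subset inter_subset_right

theorem isOpen_sector (hω : ω ≤ 2 * Real.pi) : IsOpen (sector ω) := by
  have hcont : ContinuousOn (fun x => Complex.arg (-toComplex x) + Real.pi) slitDomain :=
    fun x hx => (((Complex.continuousAt_arg hx).comp (x := x)
      toComplex.continuous.neg.continuousAt).add continuousAt_const).continuousWithinAt
  rw [sector_eq_inter hω]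
  exact (hcont.isOpen_inter_preimage isOpen_slitDomain isOpen_Iio).inter isOpen_ball

theorem norm_polar_sub_polar_sq (r r' φ ψ : ℝ) :
    ‖polar r φ - polar r' ψ‖ ^ 2 =
      (r - r') ^ 2 + 4 * (r * r') * Real.sin ((φ - ψ) / 2) ^ 2 := by
  have hcos : Real.cos (φ - ψ) = 1 - 2 * Real.sin ((φ - ψ) / 2) ^ 2 := by
    rw [Real.sin_sq_eq_half_sub, mul_div_cancel₀ (φ - ψ) two_ne_zero]
    ring
  rw [EuclideanSpace.norm_sq_eq]
  simp only [polar, Fin.sum_univ_two, Real.norm_eq_abs, sq_abs, PiLp.sub_apply,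
    Matrix.cons_val_zero, Matrix.cons_val_one]
  rw [Real.cos_sub] at hcos
  linear_combination r ^ 2 * Real.sin_sq_add_cos_sq φ + r' ^ 2 * Real.sin_sq_add_cos_sq ψ -
    2 * r * r' * hcos

theorem abs_sub_le_norm_polar_sub_polar (hr : 0 ≤ r) (hr' : 0 ≤ r') :
    |r - r'| ≤ ‖polar r φ - polar r' ψ‖ := by
  simpa only [norm_polar hr, norm_polar hr'] using abs_norm_sub_norm_le (polar r φ) (polar r' ψ)

theorem max_mul_abs_sin_le_norm_polar_sub_polar (hr : 0 ≤ r) (hr' : 0 ≤ r') :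
    max r r' * |Real.sin ((φ - ψ) / 2)| ≤ ‖polar r φ - polar r' ψ‖ := by
  set S := Real.sin ((φ - ψ) / 2)
  have sq_le {R t : ℝ} (hR : 0 ≤ R) (ht : 0 ≤ t) :
      R ^ 2 * S ^ 2 ≤ (R - t) ^ 2 + 4 * (R * t) * S ^ 2 := by
    have hS : 0 ≤ (R - t) ^ 2 * (1 - S ^ 2) :=
      mul_nonneg (sq_nonneg _) (sub_nonneg.2 (Real.sin_sq_le_one _))
    have hRt : 0 ≤ (t ^ 2 + 2 * (R * t)) * S ^ 2 := by positivity
    linarith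
  refine (le_abs_self _).trans (abs_le_of_sq_le_sq ?_ (norm_nonneg _))
  rw [mul_pow, sq_abs, norm_polar_sub_polar_sq]
  rcases max_choice r r' with h | h <;> rw [h]
  · exact sq_le hr hr'
  · linarith [sq_le hr' hr]

theorem norm_polar_sub_polar_le {R : ℝ} (hr : r ∈ Icc 0 R) (hr' : r' ∈ Icc 0 R) :
    ‖polar r φ - polar r' ψ‖ ≤ |r - r'| + R * |φ - ψ| := by
  have hR : 0 ≤ R := hr.1.trans hr.2
  refine (le_abs_self _).trans (abs_le_of_sq_le_sq ?_ (by positivity))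
  rw [norm_polar_sub_polar_sq]
  calc (r - r') ^ 2 + 4 * (r * r') * Real.sin ((φ - ψ) / 2) ^ 2
      ≤ (r - r') ^ 2 + 4 * (R * R) * ((φ - ψ) / 2) ^ 2 := by
        gcongr _ + 4 * (?_ * ?_) * ?_
        · exact hr'.1
        · exact hr.2
        · exact hr'.2
        · exact sq_le_sq.2 Real.abs_sin_le_abs
    _ = |r - r'| ^ 2 + (R * |φ - ψ|) ^ 2 := by rw [mul_pow, sq_abs, sq_abs]; ring
    _ ≤ (|r - r'| + R * |φ - ψ|) ^ 2 := by
        rw [add_sq]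
        linarith [show 0 ≤ 2 * |r - r'| * (R * |φ - ψ|) by positivity]

-- The path moves linearly in polar coordinates.
theorem innerEDist_sector_polar_le (hr : r ∈ Ioo 0 1) (hr' : r' ∈ Ioo 0 1) (hφ : φ ∈ Ioo 0 ω)
    (hψ : ψ ∈ Ioo 0 ω) : innerEDist (sector ω) (polar r φ) (polar r' ψ) ≤
      ENNReal.ofReal (|r - r'| + max r r' * |φ - ψ|) := by
  have hlip : LipschitzOnWith (Real.toNNReal (|r - r'| + max r r' * |φ - ψ|))
      (fun t : ℝ => polar (AffineMap.lineMap r r' t) (AffineMap.lineMap φ ψ t)) (Icc 0 1) := by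
    have mem_Icc {t : ℝ} (ht : t ∈ Icc (0 : ℝ) 1) : AffineMap.lineMap r r' t ∈ Icc 0 (max r r') :=
      (convex_Icc _ _).lineMap_mem ⟨hr.1.le, le_max_left r r'⟩ ⟨hr'.1.le, le_max_right r r'⟩ ht
    refine .of_dist_le_mul fun s hs t ht => ?_
    rw [Real.coe_toNNReal _ (add_nonneg (abs_nonneg _)
      (mul_nonneg (le_max_of_le_left hr.1.le) (abs_nonneg _))), dist_eq_norm]
    refine (norm_polar_sub_polar_le (mem_Icc hs) (mem_Icc ht)).trans_eq ?_
    rw [← Real.dist_eq, ← Real.dist_eq, dist_lineMap_lineMap, dist_lineMap_lineMap, ← Real.dist_eq,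
      ← Real.dist_eq]
    ring
  have hmem (t) (ht : t ∈ Icc (0 : ℝ) 1) :
      polar (AffineMap.lineMap r r' t) (AffineMap.lineMap φ ψ t) ∈ sector ω := by
    rw [sector_eq_image2_polar]
    exact mem_image2_of_mem ((convex_Ioo _ _).lineMap_mem hr hr' ht)
      ((convex_Ioo _ _).lineMap_mem hφ hψ ht)
  have hle := innerEDist_le_of_lipschitzOnWith hlip hmem
  simp only [AffineMap.lineMap_apply_zero, AffineMap.lineMap_apply_one] at hle
  exact hle

theorem sin_half_div_mul_abs_le {θ : ℝ} (hω : 0 < ω) (hω' : ω ≤ 2 * Real.pi) (hθ : |θ| ≤ ω) :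
    Real.sin (ω / 2) / ω * |θ| ≤ |Real.sin (θ / 2)| := by
  have habs : |θ / 2| = |θ| / 2 := by rw [abs_div, abs_two]
  rw [Real.abs_sin_eq_sin_abs_of_abs_le_pi (by rw [habs]; linarith), habs]
  have hconcave := strictConcaveOn_sin_Icc.concaveOn.2
    (show ω / 2 ∈ Icc 0 Real.pi from ⟨by linarith, by linarith⟩) (left_mem_Icc.2 Real.pi_pos.le)
    (show 0 ≤ |θ| / ω by positivity) (sub_nonneg.2 ((div_le_one hω).2 hθ)) (by ring)
  simp only [smul_eq_mul, Real.sin_zero, mul_zero, add_zero] at hconcave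
  rwa [div_mul_div_cancel₀ hω.ne', div_mul_comm] at hconcave

theorem exists_innerEDist_sector_le_mul_edist (hω : ω < 2 * Real.pi) :
    ∃ K : ℝ≥0, ∀ x ∈ sector ω, ∀ y ∈ sector ω, innerEDist (sector ω) x y ≤ K * edist x y := by
  set c := Real.sin (ω / 2) / ω
  refine ⟨Real.toNNReal (1 + 1 / c), ?_⟩
  rw [sector_eq_image2_polar]
  rintro _ ⟨r, hr, φ, hφ, rfl⟩ _ ⟨r', hr', ψ, hψ, rfl⟩
  rw [← sector_eq_image2_polar]
  have hω0 : 0 < ω := hφ.1.trans hφ.2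
  have hc : 0 < c := div_pos (Real.sin_pos_of_pos_of_lt_pi (by linarith) (by linarith)) hω0
  have hangle : c * |φ - ψ| ≤ |Real.sin ((φ - ψ) / 2)| := sin_half_div_mul_abs_le hω0 hω.le
    (abs_le.2 ⟨by linarith [hφ.1, hψ.2], by linarith [hφ.2, hψ.1]⟩)
  have harc : max r r' * |φ - ψ| ≤ 1 / c * ‖polar r φ - polar r' ψ‖ := by
    rw [one_div_mul_eq_div, le_div_iff₀ hc]
    calc max r r' * |φ - ψ| * c = max r r' * (c * |φ - ψ|) := by ring
      _ ≤ max r r' * |Real.sin ((φ - ψ) / 2)| :=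
        mul_le_mul_of_nonneg_left hangle (le_max_of_le_left hr.1.le)
      _ ≤ ‖polar r φ - polar r' ψ‖ := max_mul_abs_sin_le_norm_polar_sub_polar hr.1.le hr'.1.le
  refine (innerEDist_sector_polar_le hr hr' hφ hψ).trans ?_
  rw [edist_dist, dist_eq_norm, ENNReal.ofNNReal_toNNReal, ← ENNReal.ofReal_mul (by positivity)]
  refine ENNReal.ofReal_le_ofReal ?_
  rw [add_mul, one_mul]
  exact add_le_add (abs_sub_le_norm_polar_sub_polar hr.1.le hr'.1.le) harc

end Sector

section SobolevRegularity

open scoped ContDiff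

variable {d : ℝ² → ℝ² → ℝ≥0∞} {Ω : Set ℝ²} {s σ β : ℝ} {u : ℝ² → ℝ} {H : ℝ² → ℂ}

theorem memSobolev_of_contDiffOn (hΩ : IsOpen Ω) (hu : ContDiffOn ℝ ∞ u Ω)
    (hLp : ∀ α, α 0 + α 1 ≤ ⌊s⌋₊ → MemLp (multiDeriv α u) 2 (volume.restrict Ω))
    (hσ : ∀ α, α 0 + α 1 = ⌊s⌋₊ → slobodeckijSq d Ω (s - ⌊s⌋₊) (multiDeriv α u) < ⊤) :
    MemSobolev d Ω s u :=
  ⟨fun α => multiDeriv α u, fun α hα =>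
    ⟨isWeakDeriv_multiDeriv hΩ α hu, hLp α hα, fun hα' _ => hσ α hα'⟩⟩

theorem memSobolev_edist_of_contDiff (hΩ : IsOpen Ω) (hΩb : Bornology.IsBounded Ω) (hs : 0 ≤ s)
    (hu : ContDiff ℝ ∞ u) : MemSobolev edist Ω s u := by
  have hsmooth (α) : ContDiff ℝ ∞ (multiDeriv α u) :=
    contDiffOn_univ.1 (contDiffOn_multiDeriv isOpen_univ α hu.contDiffOn)
  refine memSobolev_of_contDiffOn hΩ hu.contDiffOn (fun α _ => ?_) fun α _ => ?_
  · obtain ⟨R, hR⟩ := hΩb.subset_closedBall 0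
    obtain ⟨C, hC⟩ := (isCompact_closedBall (0 : ℝ²) R).exists_bound_of_continuousOn
      (hsmooth α).continuous.continuousOn
    have := isFiniteMeasure_restrict.2 (hΩb.measure_lt_top (μ := volume)).ne
    exact .of_bound (hsmooth α).continuous.aestronglyMeasurable C
      ((ae_restrict_mem hΩ.measurableSet).mono fun x hx => hC x (hR hx))
  · obtain ⟨w, hw⟩ := exists_isHajlaszWeight_of_contDiff hΩb ((hsmooth α).of_le (by simp))
    exact hw.slobodeckijSq_lt_top hΩ.measurableSet hΩb (fun _ _ _ _ => le_rfl)
      (sub_nonneg.2 (Nat.floor_le hs)) (by linarith [Nat.lt_floor_add_one s]) le_rfl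

theorem memSobolev_powMode (hΩ : IsOpen Ω) (hΩs : Ω ⊆ slitDomain) (hΩb : Bornology.IsBounded Ω)
    (hd : ∀ x ∈ Ω, ∀ y ∈ Ω, edist x y ≤ d x y) (hs : 0 ≤ s) (hsβ : s < β + 1)
    (hH : ContDiff ℝ ∞ H)
    (hweight : ∀ (γ : ℝ) (G : ℝ² → ℂ), s - ⌊s⌋₊ < γ + 1 → ContDiff ℝ ∞ G →
      ∃ q w, 2 * (s - ⌊s⌋₊) < q ∧ q ≤ 2 ∧ IsHajlaszWeight d Ω q (powMode γ G) w) :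
    MemSobolev d Ω s (powMode β H) := by
  have hfloor := Nat.floor_le hs
  have hu : ContDiffOn ℝ ∞ (powMode β H) Ω := (contDiffOn_powMode β hH).mono hΩs
  refine memSobolev_of_contDiffOn hΩ hu (fun α hα => ?_) fun α hα => ?_
  · obtain ⟨G, hG, hEq⟩ := exists_multiDeriv_powMode α β hH
    have hα' : ((α 0 + α 1 : ℕ) : ℝ) ≤ ⌊s⌋₊ := Nat.cast_le.2 hα
    obtain ⟨C, -, hC⟩ := exists_abs_powMode_le hΩs hΩb (le_refl (β - (α 0 + α 1 : ℕ)))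
      hG.continuous
    exact memLp_two_of_abs_le_norm_rpow hΩ.measurableSet hΩb
      (contDiffOn_multiDeriv hΩ α hu).continuousOn (by linarith)
      fun x hx => (congrArg _ (hEq (hΩs hx))).trans_le (hC x hx)
  · obtain ⟨G, hG, hEq⟩ := exists_multiDeriv_powMode α β hH
    rw [slobodeckijSq_congr hΩ.measurableSet (hEq.mono hΩs), hα]
    obtain ⟨q, w, hσq, hq, hw⟩ := hweight (β - ⌊s⌋₊) G (by linarith) hG
    exact hw.slobodeckijSq_lt_top hΩ.measurableSet hΩb hd (sub_nonneg.2 hfloor) hσq hq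

theorem exists_isHajlaszWeight_innerEDist_powMode (hΩ : IsOpen Ω) (hΩs : Ω ⊆ slitDomain)
    (hΩb : Bornology.IsBounded Ω) (hσ : 0 ≤ σ) (hσ1 : σ < 1) (hσβ : σ < β + 1)
    (hH : ContDiff ℝ ∞ H) :
    ∃ q w, 2 * σ < q ∧ q ≤ 2 ∧ IsHajlaszWeight (innerEDist Ω) Ω q (powMode β H) w := by
  obtain ⟨q, hσq, hq⟩ : ∃ q, 2 * σ < q ∧ q < 2 * min β 0 + 2 :=
    exists_between (by rcases min_choice β 0 with h | h <;> rw [h] <;> linarith)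
  have hb : min β 0 ≤ 0 := min_le_right β 0
  obtain ⟨C, h0, h1⟩ := exists_powMode_growth hΩs hΩb (min_le_left β 0) hH
  exact ⟨q, _, hσq, by linarith, isHajlaszWeight_innerEDist hΩ hΩb
    (fun h => zero_notMem_slitDomain (hΩs h)) (fun z hz => differentiableAt_powMode β hH (hΩs hz))
    (by linarith) h0 h1 (by linarith) (by linarith) (by linarith)⟩

theorem exists_isHajlaszWeight_edist_powMode (hΩs : Ω ⊆ slitDomain)
    (hΩb : Bornology.IsBounded Ω) (hσ : 0 ≤ σ) (hσ1 : σ < 1 / 2) (hσβ : σ < β + 1)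
    (hH : ContDiff ℝ ∞ H) :
    ∃ q w, 2 * σ < q ∧ q ≤ 2 ∧ IsHajlaszWeight edist Ω q (powMode β H) w := by
  obtain ⟨q, hσq, hq⟩ : ∃ q, 2 * σ < q ∧ q < min (2 * min β 0 + 2) 1 := exists_between
    (lt_min (by rcases min_choice β 0 with h | h <;> rw [h] <;> linarith) (by linarith))
  obtain ⟨hqb, hq1⟩ := lt_min_iff.1 hq
  obtain ⟨R, hR⟩ := hΩb.subset_ball 0
  obtain ⟨C, h0, h1⟩ := exists_powMode_growth inter_subset_left
    (isBounded_ball.subset inter_subset_right) (min_le_left β 0) hH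
  exact ⟨q, _, hσq, by linarith, (isHajlaszWeight_edist_slitDomain
    (fun z hz => differentiableAt_powMode β hH hz.1) (min_le_right β 0) h0 h1 (by linarith) hq1
    (by linarith)).mono (subset_inter hΩs hR)⟩

theorem memSobolev_innerEDist_powMode (hΩ : IsOpen Ω) (hΩs : Ω ⊆ slitDomain)
    (hΩb : Bornology.IsBounded Ω) (hs : 0 ≤ s) (hsβ : s < β + 1) (hH : ContDiff ℝ ∞ H) :
    MemSobolev (innerEDist Ω) Ω s (powMode β H) :=
  memSobolev_powMode hΩ hΩs hΩb (fun x _ y _ => edist_le_innerEDist Ω x y) hs hsβ hH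
    fun _ _ hγ hG => exists_isHajlaszWeight_innerEDist_powMode hΩ hΩs hΩb
      (sub_nonneg.2 (Nat.floor_le hs)) (by linarith [Nat.lt_floor_add_one s]) hγ hG

theorem memSobolev_edist_powMode_of_innerEDist_le (hΩ : IsOpen Ω) (hΩs : Ω ⊆ slitDomain)
    (hΩb : Bornology.IsBounded Ω) (K : ℝ≥0)
    (hK : ∀ x ∈ Ω, ∀ y ∈ Ω, innerEDist Ω x y ≤ K * edist x y) (hs : 0 ≤ s) (hsβ : s < β + 1)
    (hH : ContDiff ℝ ∞ H) : MemSobolev edist Ω s (powMode β H) := by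
  have hσ : 0 ≤ s - ⌊s⌋₊ := sub_nonneg.2 (Nat.floor_le hs)
  refine memSobolev_powMode hΩ hΩs hΩb (fun _ _ _ _ => le_rfl) hs hsβ hH fun γ G hγ hG => ?_
  obtain ⟨q, w, hσq, hq, hw⟩ := exists_isHajlaszWeight_innerEDist_powMode hΩ hΩs hΩb hσ
    (by linarith [Nat.lt_floor_add_one s]) hγ hG
  exact ⟨q, _, hσq, hq, hw.of_le_mul (by linarith) K hK⟩

theorem memSobolev_edist_powMode_of_lt_half (hΩ : IsOpen Ω) (hΩs : Ω ⊆ slitDomain)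
    (hΩb : Bornology.IsBounded Ω) (hs : 0 ≤ s) (hs2 : s - ⌊s⌋₊ < 1 / 2) (hsβ : s < β + 1)
    (hH : ContDiff ℝ ∞ H) : MemSobolev edist Ω s (powMode β H) :=
  memSobolev_powMode hΩ hΩs hΩb (fun _ _ _ _ => le_rfl) hs hsβ hH fun _ _ hγ hG =>
    exists_isHajlaszWeight_edist_powMode hΩs hΩb (sub_nonneg.2 (Nat.floor_le hs)) hs2 hγ hG

theorem memSobolev_edist_powMode_natCast (hΩ : IsOpen Ω) (hΩs : Ω ⊆ slitDomain)
    (hΩb : Bornology.IsBounded Ω) (hs : 0 ≤ s) (n : ℕ) (hH : ContDiff ℝ ∞ H) :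
    MemSobolev edist Ω s (powMode n H) := by
  have hsmooth : ContDiff ℝ ∞ fun x => (toComplex x ^ n * H x).re :=
    Complex.reCLM.contDiff.comp ((toComplex.contDiff.pow n).mul hH)
  refine (memSobolev_edist_of_contDiff hΩ hΩb hs hsmooth).congr hΩ.measurableSet fun x hx => ?_
  rw [powMode, branchPow_natCast n (hΩs hx)]

end SobolevRegularity

section Bessel

open scoped ContDiff

/-- The coefficients of the entire factor `besselEntire` of the Bessel function. -/
def besselCoeff (ν : ℝ) (j : ℕ) : ℝ :=
  (-1 : ℝ) ^ j / ((j.factorial : ℝ) * Real.Gamma (ν + j + 1))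

/-- The entire factor `t ↦ ∑ (-t) ^ j / (j! Γ (ν + j + 1))` of the Bessel function, for which
`J_ν(x) = (x / 2) ^ ν * besselEntire ν ((x / 2) ^ 2)`. -/
def besselEntire (ν t : ℝ) : ℝ :=
  ∑' j, besselCoeff ν j * t ^ j

/-- The smooth factor of the eigenmode, namely `J_ν(μ ‖x‖) / ‖x‖ ^ ν`. -/
def besselProfile (ν μ : ℝ) (x : ℝ²) : ℝ :=
  (μ / 2) ^ ν * besselEntire ν ((μ / 2) ^ 2 * ‖x‖ ^ 2)

variable {ν μ : ℝ}

theorem besselCoeff_ne_zero (hν : -1 < ν) (j : ℕ) : besselCoeff ν j ≠ 0 := by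
  have hj : 0 < ν + j + 1 := by linarith [(j.cast_nonneg : (0 : ℝ) ≤ j)]
  exact div_ne_zero (pow_ne_zero j (by norm_num))
    (mul_ne_zero (Nat.cast_ne_zero.2 j.factorial_ne_zero) (Real.Gamma_pos_of_pos hj).ne')

theorem besselCoeff_succ (hν : -1 < ν) (j : ℕ) :
    besselCoeff ν (j + 1) = -(1 / ((j + 1) * (ν + j + 1))) * besselCoeff ν j := by
  have hj : 0 < ν + j + 1 := by linarith [(j.cast_nonneg : (0 : ℝ) ≤ j)]
  have hG := (Real.Gamma_pos_of_pos hj).ne'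
  have hf : (j.factorial : ℝ) ≠ 0 := Nat.cast_ne_zero.2 j.factorial_ne_zero
  rw [besselCoeff, besselCoeff, Nat.factorial_succ, pow_succ,
    show ν + (j + 1 : ℕ) + 1 = ν + j + 1 + 1 by push_cast; ring, Real.Gamma_add_one hj.ne']
  push_cast
  field_simp

theorem tendsto_norm_besselCoeff_ratio (hν : -1 < ν) :
    Filter.Tendsto (fun j => ‖besselCoeff ν (j + 1)‖ / ‖besselCoeff ν j‖) Filter.atTop
      (nhds 0) := by
  have heq (j : ℕ) : ‖besselCoeff ν (j + 1)‖ / ‖besselCoeff ν j‖ =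
      ‖(1 / ((j : ℝ) + 1)) * (1 / (ν + j + 1))‖ := by
    rw [besselCoeff_succ hν, norm_mul, norm_neg,
      mul_div_cancel_right₀ _ (norm_ne_zero_iff.2 (besselCoeff_ne_zero hν j)), one_div_mul_one_div]
  simp only [heq]
  have hlin : Filter.Tendsto (fun j : ℕ => ν + j + 1) Filter.atTop Filter.atTop :=
    Filter.tendsto_atTop_add_const_right _ _
      (Filter.tendsto_atTop_add_const_left _ _ tendsto_natCast_atTop_atTop)
  simpa using (tendsto_one_div_add_atTop_nhds_zero_nat.mul
    (hlin.const_div_atTop 1)).norm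

theorem contDiff_besselEntire (hν : -1 < ν) : ContDiff ℝ ∞ (besselEntire ν) := by
  let p := FormalMultilinearSeries.ofScalars ℝ (besselCoeff ν)
  have hrad : p.radius = ⊤ := FormalMultilinearSeries.ofScalars_radius_eq_top_of_tendsto ℝ _
    (.of_forall (besselCoeff_ne_zero hν)) (tendsto_norm_besselCoeff_ratio hν)
  have hsum : p.sum = besselEntire ν := by
    funext t
    simp [p, FormalMultilinearSeries.sum, besselEntire, mul_comm]
  have han := (p.hasFPowerSeriesOnBall (by rw [hrad]; exact ENNReal.zero_lt_top)).analyticOnNhd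
  rw [hsum, hrad, eball_top] at han
  exact contDiffOn_univ.1 (han.contDiffOn uniqueDiffOn_univ)

theorem contDiff_besselProfile (hν : -1 < ν) (μ : ℝ) : ContDiff ℝ ∞ (besselProfile ν μ) :=
  contDiff_const.mul ((contDiff_besselEntire hν).comp (contDiff_const.mul (contDiff_norm_sq ℝ)))

theorem besselJ_eq {x : ℝ} (hx : 0 < x) :
    besselJ ν x = (x / 2) ^ ν * besselEntire ν ((x / 2) ^ 2) := by
  have hx2 : 0 < x / 2 := half_pos hx
  rw [besselJ, besselEntire, ← tsum_mul_left]
  refine tsum_congr fun j => ?_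
  rw [Real.rpow_add hx2, Real.rpow_mul hx2.le, Real.rpow_two, Real.rpow_natCast, besselCoeff]
  ring

theorem eigenmode_eqOn_powMode (hμ : 0 < μ) :
    EqOn (eigenmode ν μ) (powMode ν fun x => (besselProfile ν μ x : ℂ)) slitDomain := by
  intro x hx
  have hr := norm_pos_of_mem_slitDomain hx
  have harg := arg_neg_toComplex_add_pi_mem_Ioo hx
  have hpolar : eigenmode ν μ x =
      besselJ ν (μ * ‖x‖) * Real.cos (ν * (Complex.arg (-toComplex x) + Real.pi)) := by
    conv_lhs => rw [← polar_norm_arg x]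
    exact eigenmode_polar ν μ _ _ hr harg.1.le harg.2
  rw [hpolar, powMode, Complex.re_mul_ofReal, branchPow_re ν hx, besselJ_eq (by positivity),
    besselProfile, mul_div_right_comm, Real.mul_rpow (by positivity) hr.le, mul_pow]
  ring

end Bessel

theorem lt_two_pi_or_exists_natCast_eq_of_even {ω : ℝ} {k : ℕ} (hω : ω ≤ 2 * Real.pi)
    (hk : Even k) : ω < 2 * Real.pi ∨ ∃ n : ℕ, k * (Real.pi / ω) = n := by
  refine hω.lt_or_eq.imp_right ?_
  rintro rfl
  obtain ⟨n, rfl⟩ := hk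
  refine ⟨n, ?_⟩
  push_cast
  field_simp
  ring

theorem lemma1_general {ω ν μ s : ℝ} (hω : ω ≤ 2 * Real.pi) (hμ : 0 < μ) (hs : 0 ≤ s)
    (hs' : s < ν + 1) :
    (ω < 2 * Real.pi ∨ (∃ n : ℕ, ν = n) ∨ s - ⌊s⌋₊ < 1 / 2 →
      MemSobolev edist (sector ω) s (eigenmode ν μ)) ∧
    MemSobolev (innerEDist (sector ω)) (sector ω) s (eigenmode ν μ) := by
  have hΩ := isOpen_sector hω
  have hΩs := sector_subset_slitDomain hω
  have hΩb := isBounded_sector hω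
  have hprofile := Complex.ofRealCLM.contDiff.comp
    (contDiff_besselProfile (show -1 < ν by linarith) μ)
  have of_powMode {d} (h : MemSobolev d (sector ω) s (powMode ν fun x => besselProfile ν μ x)) :
      MemSobolev d (sector ω) s (eigenmode ν μ) :=
    h.congr hΩ.measurableSet ((eigenmode_eqOn_powMode hμ).mono hΩs).symm
  refine ⟨fun h => of_powMode ?_,
    of_powMode (memSobolev_innerEDist_powMode hΩ hΩs hΩb hs hs' hprofile)⟩
  rcases h with hangle | ⟨n, rfl⟩ | hhalf
  · obtain ⟨K, hK⟩ := exists_innerEDist_sector_le_mul_edist hangle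
    exact memSobolev_edist_powMode_of_innerEDist_le hΩ hΩs hΩb K hK hs hs' hprofile
  · exact memSobolev_edist_powMode_natCast hΩ hΩs hΩb hs n hprofile
  · exact memSobolev_edist_powMode_of_lt_half hΩ hΩs hΩb hs hhalf hs' hprofile

end

theorem lemma1 (ω : ℝ) (hω : 0 < ω) (hω' : ω ≤ 2 * Real.pi) (k m : ℕ) (hm : 1 ≤ m)
    (ν μ : ℝ) (hν : ν = k * (Real.pi / ω)) (hμ : IsBesselZero ν m μ)
    (s : ℝ) (hs : 0 ≤ s) (hs' : s < ν + 1) :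
    (ω < 2 * Real.pi ∨ Even k ∨ s - ⌊s⌋₊ < 1 / 2 →
      MemSobolev edist (sector ω) s (eigenmode ν μ)) ∧
    MemSobolev (innerEDist (sector ω)) (sector ω) s (eigenmode ν μ) := by
  subst hν
  exact (lemma1_general hω' hμ.1 hs hs').imp_left fun h hcase => h (by
    rcases hcase with hangle | heven | hhalf
    · exact .inl hangle
    · exact (lt_two_pi_or_exists_natCast_eq_of_even hω' heven).imp_right .inl
    · exact .inr (.inr hhalf))
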